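/- Let $n\ge 2$, $X\in\mathbb R^{n\times p}$, $y\in\mathbb R^n$, $\lambda>0$, let $\mathcal G_1,\dots,\mathcal G_g$ be a partition of $\{1,\dots,p\}$ with weights $w_l>0$, and put $$L(s)=\frac1{n(n-1)}\sum_{i}\sum_{j\ne i}|s_i-s_j|,\qquad \Psi(\beta)=\sum_{l=1}^g w_l\|\beta_{\mathcal G_l}\|_2 .$$ Consider the problem $(P')$ $\min_{s,\beta}\{L(s)+\lambda\Psi(\beta)\mid X\beta-s-y=0\}$ and its dual $(D)$ $\min_w\{\langle y,w\rangle+L^*(w)+\lambda\Psi^*(-\lambda^{-1}X^\top w)\}$, with the Lagrangian $l(w;s,\beta)=\langle y,w\rangle-L(s)-\lambda\Psi(\beta)+\langle s,w\rangle-\langle\beta,X^\top w\rangle$, the augmented Lagrangian $\mathcal L_\sigma(w;s,\beta)=\sup_{\nu,\phi}\{l(w;\nu,\phi)-\frac1{2\sigma}\|\nu-s\|_2^2-\frac1{2\sigma}\|\phi-\beta\|_2^2\}$, and the operator $$\mathcal T(w,s,\beta)=\{(w',s',\beta')\mid w'=y+s-X\beta,\ s'\in-w+\partial L(s),\ \beta'\in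 X^\top w+\partial(\lambda\Psi)(\beta)\},$$ whose zero set $\mathcal T^{-1}(0)$ is the set of KKT points. Let $\tau>0$, $0<\sigma_0\le\sigma_1\le\cdots$, and let $(\delta_k)$ be summable with $0<\delta_k<1$. Let $(w^k,s^k,\beta^k)_{k\ge0}$ be an infinite sequence generated by the inexact proximal augmented Lagrangian method: with $\psi_k(w)=\mathcal L_{\sigma_k}(w;s^k,\beta^k)+\frac{\tau}{2\sigma_k}\|w-w^k\|_2^2$, for all $k$, $$s^{k+1}=\sigma_k\mathrm{Prox}_L(s^k/\sigma_k+w^{k+1}),\qquad \beta^{k+1}=\sigma_k\lambda\,\mathrm{Prox}_\Psi(\beta^k/(\sigma_k\lambda)-X^\top w^{k+1}/\lambda),$$ $$\|\nabla\psi_k(w^{k+1})\|_2\le\frac{\delta_k\min(1,\sqrt\tau)}{\sigma_k}\min\{1,\|(\sqrt\tau w^{k+1},s^{k+1},\beta^{k+1})-(\sqrt\tau w^k,s^k,\beta^k)\|_2\}.$$ Write $\|(w,s,\beta)\|_{\mathcal M}^2=\tau\|w\|_2^2+\|s\|_2^2+\|\beta\|_2^2$, let $\mathrm{dist}_{\mathcal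 M}$ and $\mathrm{dist}$ be the distances for $\|\cdot\|_{\mathcal M}$ and for the Euclidean norm, and let $\gamma=\max\{1,\tau\}$. For $r,\kappa>0$ let $(\mathrm{EB})$ be the condition $$\mathrm{dist}(z,\mathcal T^{-1}(0))\le\kappa\,\mathrm{dist}(0,\mathcal T(z))\quad\text{for all } z \text{ with } \mathrm{dist}(z,\mathcal T^{-1}(0))\le r .$$ (1) $(s^k,\beta^k)$ converges to an optimal solution of $(P')$, and $w^k$ converges to an optimal solution of $(D)$. (2) If every group has at most one element (so that the objective is piecewise linear-quadratic), then for each $r>\sum_k\delta_k$ there is $\kappa>0$ such that $(\mathrm{EB})$ holds. (3) Let $r>\sum_k\delta_k$ and $\kappa>0$ be such that $(\mathrm{EB})$ holds. If $\mathrm{dist}((w^0,s^0,\beta^0),\mathcal T^{-1}(0))\le r-\sum_k\delta_k$, then for all $k\ge0$ $$\mathrm{dist}_{\mathcal M}((w^{k+1},s^{k+1},\beta^{k+1}),\mathcal T^{-1}(0))\le\mu_k\,\mathrm{dist}_{\mathcal M}((w^k,s^k,\beta^k),\mathcal T^{-1}(0)),\qquad \mu_k=\frac{1}{1-\delta_k}\Big(\delta_k+\frac{(1+\delta_k)\kappa\gamma}{\sqrt{\sigma_k^2+\kappa^2\gamma^2}}\Big).$$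 If $\sigma_k\to\sigma_\infty<\infty$, then $\mu_k\to\kappa\gamma/\sqrt{\sigma_\infty^2+\kappa^2\gamma^2}<1$; in all cases the $\mathcal M$-weighted distances to $\mathcal T^{-1}(0)$ converge Q-linearly to zero, that is, for some $\rho<1$ each is at most $\rho$ times the preceding one for all large $k$. If $\sigma_k\to\infty$, then $\mu_k\to0$ and the distances converge Q-superlinearly: $\mathrm{dist}_{\mathcal M}((w^{k+1},s^{k+1},\beta^{k+1}),\mathcal T^{-1}(0))=o\big(\mathrm{dist}_{\mathcal M}((w^k,s^k,\beta^k),\mathcal T^{-1}(0))\big)$. -/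

import Mathlib

open Filter Topology Asymptotics

noncomputable section

namespace RankRegression

/-- `ℝᵐ` with the Euclidean norm. -/
abbrev Vec (m : ℕ) : Type := EuclideanSpace ℝ (Fin m)

/-- Primal-dual points `(w, s, β) ∈ ℝⁿ × ℝⁿ × ℝᵖ`. Only the algebraic structure of the product is
used; norms and distances on it are `wnorm` and `wdist` below. -/
abbrev Point (n p : ℕ) : Type := Vec n × Vec n × Vec p

/-- The matrix-vector product `A v` on Euclidean spaces. -/
def mulVecE {m q : ℕ} (A : Matrix (Fin m) (Fin q) ℝ) (v : Vec q) : Vec m :=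
  WithLp.toLp 2 (A.mulVec (WithLp.ofLp v))

/-! ### General convex analysis -/

section Convex

variable {m : ℕ}

/-- The convex subdifferential `∂f(x)`. -/
def subdiff (f : Vec m → ℝ) (x : Vec m) : Set (Vec m) :=
  {v | ∀ z, f x + inner ℝ v (z - x) ≤ f z}

/-- `u = Prox_f(x)`: `u` minimizes `f(u) + ‖u - x‖² / 2`
(for convex `f` the minimizer exists and is unique). -/
def IsProx (f : Vec m → ℝ) (x u : Vec m) : Prop :=
  ∀ v, f u + ‖u - x‖ ^ 2 / 2 ≤ f v + ‖v - x‖ ^ 2 / 2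

/-- The convex conjugate `f*(v) = sup_x (⟨v, x⟩ - f(x))`, with values in `[-∞, ∞]`. -/
def conj (f : Vec m → ℝ) (v : Vec m) : EReal :=
  ⨆ x : Vec m, ((inner ℝ v x - f x : ℝ) : EReal)

end Convex

/-! ### The group lasso regularized rank regression problem -/

/-- Data of the problem: design matrix, response, the partition of the coefficient indices into
the groups `𝒢_l = {j | group j = l}`, positive group weights, and the parameter `λ > 0`. -/
structure Problem (n p g : ℕ) where
  X : Matrix (Fin n) (Fin p) ℝ
  y : Vec n
  group : Fin p → Fin g
  weight : Fin g → ℝ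
  weight_pos : ∀ l, 0 < weight l
  lam : ℝ
  lam_pos : 0 < lam

/-- The Wilcoxon rank loss `L(s) = (n (n - 1))⁻¹ ∑ᵢ ∑_{j ≠ i} |sᵢ - sⱼ|`. -/
def rankLoss {n : ℕ} (s : Vec n) : ℝ :=
  1 / ((n : ℝ) * ((n : ℝ) - 1)) *
    ∑ i : Fin n, ∑ j ∈ Finset.univ.filter (fun j => j ≠ i), |s i - s j|

namespace Problem

variable {n p g : ℕ} (P : Problem n p g)

/-- The group lasso regularizer `Ψ(β) = ∑_l w_l ‖β_{𝒢_l}‖₂`. -/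
def reg (β : Vec p) : ℝ :=
  ∑ l : Fin g, P.weight l *
    Real.sqrt (∑ j ∈ Finset.univ.filter (fun j => P.group j = l), β j ^ 2)

/-- `(s, β)` solves `min {L(s) + λ Ψ(β) | X β - s - y = 0}`. -/
def IsPrimalOptimal (s : Vec n) (β : Vec p) : Prop :=
  mulVecE P.X β - s - P.y = 0 ∧
    ∀ (s' : Vec n) (β' : Vec p), mulVecE P.X β' - s' - P.y = 0 →
      rankLoss s + P.lam * P.reg β ≤ rankLoss s' + P.lam * P.reg β'

/-- The dual objective `g(w) = ⟨y, w⟩ + L*(w) + λ Ψ*(-λ⁻¹ Xᵀ w)`. -/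
def dualObj (w : Vec n) : EReal :=
  ((inner ℝ P.y w : ℝ) : EReal) + conj rankLoss w +
    (P.lam : EReal) * conj P.reg (-(P.lam⁻¹ • mulVecE P.X.transpose w))

/-- `w` solves the dual problem `min_w g(w)`, with a finite optimal value. -/
def IsDualOptimal (w : Vec n) : Prop :=
  P.dualObj w ≠ ⊤ ∧ P.dualObj w ≠ ⊥ ∧ ∀ w' : Vec n, P.dualObj w ≤ P.dualObj w'

/-- The Lagrangian `l(w; s, β)` of the dual problem. -/
def lagrangian (w s : Vec n) (β : Vec p) : ℝ :=
  inner ℝ P.y w - rankLoss s - P.lam * P.reg β + inner ℝ s w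
    - inner ℝ β (mulVecE P.X.transpose w)

/-- The augmented Lagrangian
`ℒ_σ(w; s, β) = sup_{ν, φ} {l(w; ν, φ) - ‖ν - s‖² / (2σ) - ‖φ - β‖² / (2σ)}`.
For `σ > 0` the supremum is over a set that is bounded above, as `L` and `Ψ` are nonnegative. -/
def augLagrangian (σ : ℝ) (w s : Vec n) (β : Vec p) : ℝ :=
  ⨆ q : Vec n × Vec p,
    (P.lagrangian w q.1 q.2 - 1 / (2 * σ) * ‖q.1 - s‖ ^ 2 - 1 / (2 * σ) * ‖q.2 - β‖ ^ 2)

/-- The maximal monotone operator `𝒯` of the Lagrangian: the set of all `(w', s', β')` with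
`w' = y + s - X β`, `s' ∈ -w + ∂L(s)`, `β' ∈ Xᵀ w + ∂(λΨ)(β)`. All its values are nonempty. -/
def kktOp (z : Point n p) : Set (Point n p) :=
  {v | v.1 = P.y + z.2.1 - mulVecE P.X z.2.2 ∧
    v.2.1 + z.1 ∈ subdiff rankLoss z.2.1 ∧
    v.2.2 - mulVecE P.X.transpose z.1 ∈ subdiff (fun β => P.lam * P.reg β) z.2.2}

/-- The KKT set `𝒯⁻¹(0)`. -/
def kktSet : Set (Point n p) := {z | (0 : Point n p) ∈ P.kktOp z}

end Problem

/-! ### Weighted norms and distances -/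

section Weighted

variable {n p : ℕ}

/-- `‖(w, s, β)‖_ℳ` for `ℳ = Diag(τ Iₙ, Iₙ, I_p)`; `τ = 1` gives the Euclidean norm. -/
def wnorm (τ : ℝ) (z : Point n p) : ℝ :=
  Real.sqrt (τ * ‖z.1‖ ^ 2 + ‖z.2.1‖ ^ 2 + ‖z.2.2‖ ^ 2)

/-- `dist_ℳ(z, S) = inf_{u ∈ S} ‖z - u‖_ℳ`. -/
def wdist (τ : ℝ) (z : Point n p) (S : Set (Point n p)) : ℝ :=
  sInf ((fun u => wnorm τ (z - u)) '' S)

/-- The Euclidean distance of a primal-dual point to a set. -/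
def eucDist (z : Point n p) (S : Set (Point n p)) : ℝ := wdist 1 z S

end Weighted

/-! ### The algorithm -/

section Algorithm

variable {n p g : ℕ}

/-- The subproblem objective `ψ(v) = ℒ_σ(v; s, β) + τ / (2σ) ‖v - w‖²` at the iterate
`(w, s, β)`. -/
def subObj (P : Problem n p g) (τ σ : ℝ) (w s : Vec n) (β : Vec p) (v : Vec n) : ℝ :=
  P.augLagrangian σ v s β + τ / (2 * σ) * ‖v - w‖ ^ 2

/-- `(w, s, β)` is an (infinite) run of the inexact proximal augmented Lagrangian method with
parameters `τ`, `σ`, `δ`. -/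
structure IsPALM (P : Problem n p g) (τ : ℝ) (σ δ : ℕ → ℝ)
    (w s : ℕ → Vec n) (β : ℕ → Vec p) : Prop where
  tau_pos : 0 < τ
  sigma_pos : 0 < σ 0
  sigma_mono : ∀ k, σ k ≤ σ (k + 1)
  delta_pos : ∀ k, 0 < δ k
  delta_lt_one : ∀ k, δ k < 1
  delta_summable : Summable δ
  /-- the inexact minimization of `ψ_k`, in terms of its gradient `G` at `w (k + 1)` -/
  step_w : ∀ k, ∃ G : Vec n,
    HasGradientAt (subObj P τ (σ k) (w k) (s k) (β k)) G (w (k + 1)) ∧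
    ‖G‖ ≤ δ k * min 1 (Real.sqrt τ) / σ k *
      min 1 (wnorm 1
        ((Real.sqrt τ • w (k + 1), s (k + 1), β (k + 1)) - (Real.sqrt τ • w k, s k, β k)))
  /-- `s (k + 1) = σ_k Prox_L(s k / σ_k + w (k + 1))` -/
  step_s : ∀ k, ∃ u : Vec n,
    IsProx rankLoss ((σ k)⁻¹ • s k + w (k + 1)) u ∧ s (k + 1) = σ k • u
  /-- `β (k + 1) = σ_k λ Prox_Ψ(β k / (σ_k λ) - Xᵀ w (k + 1) / λ)` -/
  step_beta : ∀ k, ∃ u : Vec p,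
    IsProx P.reg
      ((σ k * P.lam)⁻¹ • β k - P.lam⁻¹ • mulVecE P.X.transpose (w (k + 1))) u ∧
    β (k + 1) = (σ k * P.lam) • u

/-- The error bound that specifies the constants `κ` and `r`:
`dist(z, 𝒯⁻¹(0)) ≤ κ dist(0, 𝒯(z))` whenever `dist(z, 𝒯⁻¹(0)) ≤ r`. -/
def ErrorBound (P : Problem n p g) (κ r : ℝ) : Prop :=
  ∀ z : Point n p, eucDist z P.kktSet ≤ r →
    eucDist z P.kktSet ≤ κ * eucDist 0 (P.kktOp z)

/-- The factor `(1 - δ)⁻¹ (δ + (1 + δ) κ γ / √(σ² + κ² γ²))` with `γ = max {1, τ}`. -/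
def rate (κ τ σ δ : ℝ) : ℝ :=
  (1 - δ)⁻¹ *
    (δ + (1 + δ) * (κ * max 1 τ) / Real.sqrt (σ ^ 2 + κ ^ 2 * (max 1 τ) ^ 2))

end Algorithm

end RankRegression

end

noncomputable section

namespace RankRegression

/-! ### Monotone operators and the proximal point algorithm -/

section Monotone

variable {H : Type*} [NormedAddCommGroup H] [InnerProductSpace ℝ H]

/-- Monotone operators with a closed graph all of whose resolvents are everywhere defined. -/
structure IsMaxMonotone (A : H → Set H) : Prop where
  mono : ∀ ⦃x x' v v' : H⦄, v ∈ A x → v' ∈ A x' → 0 ≤ inner ℝ (v - v') (x - x')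
  closed : IsClosed {q : H × H | q.2 ∈ A q.1}
  range : ∀ (c : ℝ), 0 < c → ∀ a : H, ∃ q, c⁻¹ • (a - q) ∈ A q

variable {A : H → Set H}

theorem IsMaxMonotone.norm_sub_le (hA : IsMaxMonotone A) {c : ℝ} (hc : 0 < c) {a a' q q' : H}
    (h : c⁻¹ • (a - q) ∈ A q) (h' : c⁻¹ • (a' - q') ∈ A q') : ‖q - q'‖ ≤ ‖a - a'‖ := by
  have h1 := hA.mono h h'
  rw [← smul_sub, inner_smul_left] at h1
  have h2 : 0 ≤ inner ℝ ((a - q) - (a' - q')) (q - q') := by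
    have : 0 < c⁻¹ := inv_pos.2 hc
    simp only [conj_trivial] at h1
    exact nonneg_of_mul_nonneg_right h1 this
  have h3 : (a - q) - (a' - q') = (a - a') - (q - q') := by abel
  rw [h3, inner_sub_left, real_inner_self_eq_norm_sq] at h2
  have h4 := real_inner_le_norm (a - a') (q - q')
  by_contra! hlt
  nlinarith [norm_nonneg (a - a'), norm_nonneg (q - q')]

theorem IsMaxMonotone.fejer (hA : IsMaxMonotone A) {c : ℝ} (hc : 0 < c) {a q z : H}
    (h : c⁻¹ • (a - q) ∈ A q) (hz : (0 : H) ∈ A z) :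
    ‖q - z‖ ^ 2 + ‖a - q‖ ^ 2 ≤ ‖a - z‖ ^ 2 := by
  have h1 := hA.mono h hz
  rw [sub_zero, inner_smul_left] at h1
  have h2 : 0 ≤ inner ℝ (a - q) (q - z) := by
    have : 0 < c⁻¹ := inv_pos.2 hc
    simp only [conj_trivial] at h1
    exact nonneg_of_mul_nonneg_right h1 this
  have h3 : a - z = (a - q) + (q - z) := by abel
  rw [h3, norm_add_sq_real]
  linarith

theorem IsMaxMonotone.norm_residual_le (hA : IsMaxMonotone A) {c : ℝ} (hc : 0 < c) {a q u : H}
    (h : c⁻¹ • (a - q) ∈ A q) (hu : u ∈ A a) : ‖c⁻¹ • (a - q)‖ ≤ ‖u‖ := by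
  have h1 := hA.mono hu h
  set v := c⁻¹ • (a - q) with hv
  have h2 : a - q = c • v := by rw [hv, smul_smul, mul_inv_cancel₀ hc.ne', one_smul]
  rw [h2, inner_smul_right] at h1
  have h3 := nonneg_of_mul_nonneg_right h1 hc
  rw [inner_sub_left, real_inner_self_eq_norm_sq] at h3
  have h4 := real_inner_le_norm u v
  by_contra! hlt
  nlinarith [norm_nonneg u, norm_nonneg v]

theorem IsMaxMonotone.infDist_sq_add_le (hA : IsMaxMonotone A) {c : ℝ} (hc : 0 < c) {a q : H}
    (h : c⁻¹ • (a - q) ∈ A q) (hZ : {z | (0 : H) ∈ A z}.Nonempty) :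
    Metric.infDist q {z | (0 : H) ∈ A z} ^ 2 + ‖a - q‖ ^ 2
      ≤ Metric.infDist a {z | (0 : H) ∈ A z} ^ 2 := by
  set Z := {z | (0 : H) ∈ A z}
  have h1 : Real.sqrt (Metric.infDist q Z ^ 2 + ‖a - q‖ ^ 2) ≤ Metric.infDist a Z := by
    refine (Metric.le_infDist hZ).2 fun z hz => ?_
    have h2 := hA.fejer hc h hz
    have h3 := Metric.infDist_le_dist_of_mem (x := q) hz
    rw [dist_eq_norm] at h3
    rw [dist_eq_norm]
    refine Real.sqrt_le_iff.2 ⟨norm_nonneg _, ?_⟩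
    have := pow_le_pow_left₀ Metric.infDist_nonneg h3 2
    linarith
  have := (Real.sqrt_le_iff.1 h1).2
  exact this

theorem tendsto_of_le_add_summable {D δ : ℕ → ℝ} (hδ : ∀ k, 0 ≤ δ k) (hs : Summable δ)
    (hD : ∀ k, 0 ≤ D k) (h : ∀ k, D (k + 1) ≤ D k + δ k) : ∃ d, Tendsto D atTop (𝓝 d) := by
  have hanti : Antitone fun k => D k - ∑ j ∈ Finset.range k, δ j := by
    refine antitone_nat_of_succ_le fun k => ?_
    rw [Finset.sum_range_succ]
    linarith [h k]
  have hbdd : BddBelow (Set.range fun k => D k - ∑ j ∈ Finset.range k, δ j) := by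
    refine ⟨-∑' j, δ j, ?_⟩
    rintro _ ⟨k, rfl⟩
    have := hs.sum_le_tsum (Finset.range k) fun j _ => hδ j
    have := hD k
    simp only
    linarith
  have h1 := tendsto_atTop_ciInf hanti hbdd
  have h2 := h1.add hs.hasSum.tendsto_sum_nat
  simp only [sub_add_cancel] at h2
  exact ⟨_, h2⟩

/-- Convergence of the inexact proximal point algorithm. -/
theorem IsMaxMonotone.tendsto_proximalPoint [FiniteDimensional ℝ H] (hA : IsMaxMonotone A)
    (hZ : {z | (0 : H) ∈ A z}.Nonempty) {x q : ℕ → H} {σ δ : ℕ → ℝ} {σ₀ : ℝ} (hσ₀ : 0 < σ₀)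
    (hσ : ∀ k, σ₀ ≤ σ k) (hδ : ∀ k, 0 ≤ δ k) (hs : Summable δ)
    (hq : ∀ k, (σ k)⁻¹ • (x k - q k) ∈ A (q k)) (hx : ∀ k, ‖x (k + 1) - q k‖ ≤ δ k) :
    ∃ z, (0 : H) ∈ A z ∧ Tendsto x atTop (𝓝 z) := by
  have : ProperSpace H := FiniteDimensional.proper_real H
  have hσp : ∀ k, 0 < σ k := fun k => hσ₀.trans_le (hσ k)
  have hqz : ∀ z, (0 : H) ∈ A z → ∀ k, ‖q k - z‖ ≤ ‖x k - z‖ := fun z hz k => by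
    have := hA.fejer (hσp k) (hq k) hz
    exact pow_le_pow_iff_left₀ (norm_nonneg _) (norm_nonneg _) two_ne_zero |>.1
      (by nlinarith [sq_nonneg ‖x k - q k‖])
  have hxq : ∀ z k, ‖x (k + 1) - z‖ ≤ ‖q k - z‖ + δ k := fun z k => by
    have := norm_add_le (x (k + 1) - q k) (q k - z)
    rw [sub_add_sub_cancel] at this
    linarith [hx k]
  have hconv : ∀ z, (0 : H) ∈ A z → ∃ d, Tendsto (fun k => ‖x k - z‖) atTop (𝓝 d) :=
    fun z hz => tendsto_of_le_add_summable hδ hs (fun _ => norm_nonneg _) fun k =>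
      (hxq z k).trans (by linarith [hqz z hz k])
  obtain ⟨z₀, hz₀⟩ := hZ
  obtain ⟨d, hd⟩ := hconv z₀ hz₀
  have hqd : Tendsto (fun k => ‖q k - z₀‖) atTop (𝓝 d) := by
    have h1 : Tendsto (fun k => ‖x (k + 1) - z₀‖ - δ k) atTop (𝓝 (d - 0)) :=
      ((tendsto_add_atTop_iff_nat 1).2 hd).sub hs.tendsto_atTop_zero
    rw [sub_zero] at h1
    exact tendsto_of_tendsto_of_tendsto_of_le_of_le h1 hd
      (fun k => by simp only; linarith [hxq z₀ k]) (fun k => hqz z₀ hz₀ k)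
  have hdiff : Tendsto (fun k => ‖x k - q k‖) atTop (𝓝 0) := by
    have h1 : Tendsto (fun k => ‖x k - z₀‖ ^ 2 - ‖q k - z₀‖ ^ 2) atTop (𝓝 0) := by
      have := (hd.pow 2).sub (hqd.pow 2)
      rwa [sub_self] at this
    have h2 : Tendsto (fun k => ‖x k - q k‖ ^ 2) atTop (𝓝 0) :=
      squeeze_zero (fun _ => sq_nonneg _)
        (fun k => by linarith [hA.fejer (hσp k) (hq k) hz₀]) h1
    have h3 := h2.sqrt
    simpa [Real.sqrt_sq (norm_nonneg _)] using h3
  have hbdd : Bornology.IsBounded (Set.range x) := by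
    obtain ⟨C, hC⟩ := hd.bddAbove_range
    refine (Metric.isBounded_closedBall (x := z₀) (r := C)).subset ?_
    rintro _ ⟨k, rfl⟩
    rw [Metric.mem_closedBall, dist_eq_norm]
    exact hC ⟨k, rfl⟩
  obtain ⟨z, -, φ, hφ, hz⟩ := tendsto_subseq_of_bounded hbdd (fun k => Set.mem_range_self k)
  have hdiff' : Tendsto (fun k => x k - q k) atTop (𝓝 0) := tendsto_zero_iff_norm_tendsto_zero.2 hdiff
  have hqz' : Tendsto (q ∘ φ) atTop (𝓝 z) := by
    have := hz.sub (hdiff'.comp hφ.tendsto_atTop)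
    rw [sub_zero] at this
    refine this.congr fun k => ?_
    simp
  have hres : Tendsto (fun k => (σ k)⁻¹ • (x k - q k)) atTop (𝓝 0) := by
    refine squeeze_zero_norm (a := fun k => σ₀⁻¹ * ‖x k - q k‖) (fun k => ?_) ?_
    · rw [norm_smul, Real.norm_of_nonneg (inv_nonneg.2 (hσp k).le)]
      exact mul_le_mul_of_nonneg_right (inv_anti₀ hσ₀ (hσ k)) (norm_nonneg _)
    · simpa using hdiff.const_mul σ₀⁻¹
  have hz0 : (0 : H) ∈ A z := by
    have := hA.closed.mem_of_tendsto (hqz'.prodMk_nhds (hres.comp hφ.tendsto_atTop))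
      (Eventually.of_forall fun k => hq (φ k))
    exact this
  refine ⟨z, hz0, ?_⟩
  obtain ⟨d', hd'⟩ := hconv z hz0
  have h0 : Tendsto ((fun k => ‖x k - z‖) ∘ φ) atTop (𝓝 0) := by
    have := (hz.sub_const z).norm
    rw [sub_self, norm_zero] at this
    exact this
  have : d' = 0 := tendsto_nhds_unique (hd'.comp hφ.tendsto_atTop) h0
  rw [this] at hd'
  exact tendsto_iff_norm_sub_tendsto_zero.2 hd'

/-- An error bound on the `r`-neighbourhood of the zero set bounds the residuals outside of it
from below. -/
theorem IsMaxMonotone.radius_le_of_errorBound [FiniteDimensional ℝ H] (hA : IsMaxMonotone A)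
    (hZ : {z | (0 : H) ∈ A z}.Nonempty) {κ r : ℝ} (hκ : 0 ≤ κ)
    (hEB : ∀ x u, Metric.infDist x {z | (0 : H) ∈ A z} ≤ r → u ∈ A x →
      Metric.infDist x {z | (0 : H) ∈ A z} ≤ κ * ‖u‖)
    {x u : H} (hu : u ∈ A x) (hx : r < Metric.infDist x {z | (0 : H) ∈ A z}) :
    r ≤ κ * ‖u‖ := by
  set Z := {z | (0 : H) ∈ A z} with hZdef
  rcases le_or_gt r 0 with hr | hr
  · exact hr.trans (by positivity)
  have key : ∀ c : ℝ, 0 < c → r ≤ κ * ‖u‖ + c * ‖u‖ := by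
    intro c hc
    choose J hJ using hA.range c hc
    obtain ⟨y, hy0, hy⟩ : ∃ y : ℕ → H, y 0 = x ∧ ∀ k, y (k + 1) = J (y k) :=
      ⟨fun k => J^[k] x, rfl, fun k => Function.iterate_succ_apply' J k x⟩
    have hres : ∀ k, c⁻¹ • (y k - y (k + 1)) ∈ A (y (k + 1)) := fun k => by
      rw [hy]; exact hJ _
    have hle : ∀ k, ‖c⁻¹ • (y k - y (k + 1))‖ ≤ ‖u‖ := by
      intro k
      induction k with
      | zero => exact hA.norm_residual_le hc (hres 0) (hy0.symm ▸ hu)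
      | succ k ih => exact (hA.norm_residual_le hc (hres (k + 1)) (hres k)).trans ih
    obtain ⟨z, hz, hlim⟩ := hA.tendsto_proximalPoint hZ (x := y) (q := fun k => y (k + 1))
      (σ := fun _ => c) (δ := fun _ => 0) hc (fun _ => le_rfl) (fun _ => le_rfl) summable_zero
      hres (fun k => by simp)
    have hex : ∃ k, Metric.infDist (y k) Z ≤ r := by
      have h1 : Tendsto (fun k => dist (y k) z) atTop (𝓝 0) := tendsto_iff_dist_tendsto_zero.1 hlim
      obtain ⟨k, hk⟩ := (h1.eventually (gt_mem_nhds hr)).exists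
      exact ⟨k, (Metric.infDist_le_dist_of_mem (s := Z) hz).trans hk.le⟩
    obtain ⟨k, h2, h1⟩ : ∃ k, r < Metric.infDist (y k) Z ∧ Metric.infDist (y (k + 1)) Z ≤ r := by
      by_contra! hcon
      obtain ⟨k, hk⟩ := hex
      have hall : ∀ k, r < Metric.infDist (y k) Z := fun k => by
        induction k with
        | zero => rwa [hy0]
        | succ k ih => exact hcon k ih
      exact (hall k).not_ge hk
    have h3 := hEB _ _ h1 (hres k)
    have h4 : dist (y k) (y (k + 1)) ≤ c * ‖u‖ := by
      have := hle k
      rw [norm_smul, Real.norm_of_nonneg (inv_nonneg.2 hc.le), inv_mul_le_iff₀ hc] at this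
      rwa [dist_eq_norm]
    have h5 := Metric.infDist_le_infDist_add_dist (s := Z) (x := y k) (y := y (k + 1))
    have h6 := mul_le_mul_of_nonneg_left (hle k) hκ
    linarith
  have hlim : Tendsto (fun c : ℝ => κ * ‖u‖ + c * ‖u‖) (𝓝[>] 0) (𝓝 (κ * ‖u‖ + 0 * ‖u‖)) :=
    ((continuous_const.add (continuous_id.mul continuous_const)).tendsto 0).mono_left
      nhdsWithin_le_nhds
  rw [zero_mul, add_zero] at hlim
  exact ge_of_tendsto hlim (eventually_mem_nhdsWithin.mono fun c hc => key c hc)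

/-- One exact proximal step under an error bound. -/
theorem IsMaxMonotone.infDist_resolvent_le (hA : IsMaxMonotone A)
    (hZ : {z | (0 : H) ∈ A z}.Nonempty) {c K : ℝ} (hc : 0 < c) (hK : 0 < K) {a q : H}
    (h : c⁻¹ • (a - q) ∈ A q)
    (hb : Metric.infDist q {z | (0 : H) ∈ A z} ≤ K * ‖c⁻¹ • (a - q)‖) :
    Metric.infDist q {z | (0 : H) ∈ A z}
      ≤ K / Real.sqrt (c ^ 2 + K ^ 2) * Metric.infDist a {z | (0 : H) ∈ A z} := by
  have h1 := hA.infDist_sq_add_le hc h hZ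
  set Z := {z | (0 : H) ∈ A z}
  rw [norm_smul, Real.norm_of_nonneg (inv_nonneg.2 hc.le)] at hb
  have hb' : c * Metric.infDist q Z ≤ K * ‖a - q‖ := by
    calc c * Metric.infDist q Z ≤ c * (K * (c⁻¹ * ‖a - q‖)) := by gcongr
      _ = K * ‖a - q‖ := by field_simp
  have hsq := pow_le_pow_left₀ (mul_nonneg hc.le Metric.infDist_nonneg) hb' 2
  have hs : 0 < Real.sqrt (c ^ 2 + K ^ 2) := Real.sqrt_pos.2 (by positivity)
  rw [div_mul_eq_mul_div, le_div_iff₀ hs]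
  refine le_of_sq_le_sq ?_ (mul_nonneg hK.le Metric.infDist_nonneg)
  rw [mul_pow, mul_pow, Real.sq_sqrt (by positivity)]
  rw [mul_pow, mul_pow] at hsq
  nlinarith [mul_le_mul_of_nonneg_left h1 (sq_nonneg K)]

/-- One inexact proximal step under an error bound. -/
theorem IsMaxMonotone.infDist_inexact_le (hA : IsMaxMonotone A)
    (hZ : {z | (0 : H) ∈ A z}.Nonempty) {c K δ : ℝ} (hc : 0 < c) (hK : 0 < K) (hδ : 0 ≤ δ)
    (hδ1 : δ < 1) {a q x : H} (h : c⁻¹ • (a - q) ∈ A q)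
    (hb : Metric.infDist q {z | (0 : H) ∈ A z} ≤ K * ‖c⁻¹ • (a - q)‖)
    (hx : ‖x - q‖ ≤ δ * ‖x - a‖) :
    Metric.infDist x {z | (0 : H) ∈ A z}
      ≤ (1 - δ)⁻¹ * (δ + (1 + δ) * K / Real.sqrt (c ^ 2 + K ^ 2)) *
        Metric.infDist a {z | (0 : H) ∈ A z} := by
  have h1 := hA.infDist_sq_add_le hc h hZ
  have h2 := hA.infDist_resolvent_le hZ hc hK h hb
  set Z := {z | (0 : H) ∈ A z}
  have h3 := Metric.infDist_le_infDist_add_dist (s := Z) (x := x) (y := q)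
  rw [dist_eq_norm] at h3
  have h4 : ‖a - q‖ ≤ Metric.infDist a Z :=
    le_of_sq_le_sq (by nlinarith [sq_nonneg (Metric.infDist q Z)]) Metric.infDist_nonneg
  have h5 : ‖x - a‖ ≤ ‖x - q‖ + ‖a - q‖ := by
    have := norm_sub_le_norm_sub_add_norm_sub x q a
    rwa [norm_sub_rev q a] at this
  have hδ' : 0 < 1 - δ := by linarith
  set R := K / Real.sqrt (c ^ 2 + K ^ 2) with hR
  have hR0 : 0 ≤ R := by positivity
  have hD : 0 ≤ Metric.infDist a Z := Metric.infDist_nonneg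
  rw [mul_div_assoc, mul_assoc, le_inv_mul_iff₀ hδ']
  have h6 : (1 - δ) * ‖x - q‖ ≤ δ * Metric.infDist a Z := by
    nlinarith [mul_le_mul_of_nonneg_left h5 hδ, mul_le_mul_of_nonneg_left h4 hδ]
  have h7 : (1 - δ) * Metric.infDist x Z
      ≤ (1 - δ) * (R * Metric.infDist a Z) + δ * Metric.infDist a Z := by
    have := mul_le_mul_of_nonneg_left (h3.trans (add_le_add_left h2 _)) hδ'.le
    linarith
  nlinarith [mul_nonneg hδ (mul_nonneg hR0 hD)]

end Monotone

/-! ### Subdifferentials -/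

section Subdiff

variable {m : ℕ}

theorem subdiff_mono {f : Vec m → ℝ} {x x' v v' : Vec m} (h : v ∈ subdiff f x)
    (h' : v' ∈ subdiff f x') : 0 ≤ (inner ℝ (v - v') (x - x') : ℝ) := by
  have h1 := h x'
  have h2 := h' x
  rw [← neg_sub x x', inner_neg_right] at h1
  rw [inner_sub_left]
  linarith

theorem isClosed_subdiff {f : Vec m → ℝ} (hf : Continuous f) :
    IsClosed {q : Vec m × Vec m | q.2 ∈ subdiff f q.1} := by
  have : {q : Vec m × Vec m | q.2 ∈ subdiff f q.1}
      = ⋂ z, {q : Vec m × Vec m | f q.1 + inner ℝ q.2 (z - q.1) ≤ f z} := by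
    ext q; simp [subdiff]
  rw [this]
  exact isClosed_iInter fun z => isClosed_le (by fun_prop) continuous_const

/-- The optimality condition for the sum of a convex function and a quadratic one. -/
theorem neg_mem_subdiff_of_isMin {f q : Vec m → ℝ} (hf : ConvexOn ℝ Set.univ f) {x g : Vec m}
    {C : Vec m → ℝ} (hq : ∀ d (t : ℝ), q (x + t • d) = q x + t * inner ℝ g d + t ^ 2 * C d)
    (hmin : ∀ z, f x + q x ≤ f z + q z) : -g ∈ subdiff f x := by
  intro z
  have key : ∀ t : ℝ, 0 < t → t ≤ 1 → 0 ≤ f z - f x + inner ℝ g (z - x) + t * C (z - x) := by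
    intro t ht ht1
    have h1 := hmin (x + t • (z - x))
    rw [hq] at h1
    have h2 := hf.2 (Set.mem_univ x) (Set.mem_univ z) (sub_nonneg.2 ht1) ht.le (by ring)
    have h3 : (1 - t) • x + t • z = x + t • (z - x) := by
      rw [smul_sub, sub_smul, one_smul]; abel
    rw [h3, smul_eq_mul, smul_eq_mul] at h2
    refine nonneg_of_mul_nonneg_right (a := t) ?_ ht
    nlinarith
  have hlim : Tendsto (fun t : ℝ => f z - f x + inner ℝ g (z - x) + t * C (z - x)) (𝓝[>] 0)
      (𝓝 (f z - f x + inner ℝ g (z - x) + 0 * C (z - x))) :=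
    ((continuous_const.add (continuous_id.mul continuous_const)).tendsto 0).mono_left
      nhdsWithin_le_nhds
  have h0 : 0 ≤ f z - f x + inner ℝ g (z - x) + 0 * C (z - x) := by
    refine ge_of_tendsto hlim ?_
    filter_upwards [Ioc_mem_nhdsGT (zero_lt_one' ℝ)] with t ht using key t ht.1 ht.2
  rw [inner_neg_left]
  linarith

theorem IsProx.sub_mem_subdiff {f : Vec m → ℝ} (hf : ConvexOn ℝ Set.univ f) {x u : Vec m}
    (h : IsProx f x u) : x - u ∈ subdiff f u := by
  have := neg_mem_subdiff_of_isMin (q := fun v => ‖v - x‖ ^ 2 / 2) (x := u) (g := u - x)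
    (C := fun d => ‖d‖ ^ 2 / 2) hf (fun d t => ?_) h
  · rwa [neg_sub] at this
  · have : u + t • d - x = (u - x) + t • d := by abel
    rw [this, norm_add_sq_real, inner_smul_right, norm_smul, mul_pow, Real.norm_eq_abs, sq_abs]
    ring

theorem smul_mem_subdiff {f : Vec m → ℝ} {x v : Vec m} {c : ℝ} (hc : 0 ≤ c)
    (h : v ∈ subdiff f x) : c • v ∈ subdiff (fun z => c * f z) x := by
  intro z
  have := mul_le_mul_of_nonneg_left (h z) hc
  rw [inner_smul_left]
  simp only [conj_trivial]
  linarith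

/-- Nonnegative, sublinear, Lipschitz continuous functions. -/
structure IsSublinear (f : Vec m → ℝ) : Prop where
  nonneg : ∀ x, 0 ≤ f x
  add_le : ∀ x y, f (x + y) ≤ f x + f y
  smul : ∀ (c : ℝ) (x), 0 ≤ c → f (c • x) = c * f x
  continuous : Continuous f
  bound : ∃ C, 0 ≤ C ∧ ∀ x, f x ≤ C * ‖x‖

theorem isSublinear_norm {F : Type*} [NormedAddCommGroup F] [NormedSpace ℝ F]
    (ℓ : Vec m →L[ℝ] F) : IsSublinear fun x => ‖ℓ x‖ where
  nonneg _ := norm_nonneg _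
  add_le x y := by rw [map_add]; exact norm_add_le _ _
  smul c x hc := by rw [map_smul, norm_smul, Real.norm_of_nonneg hc]
  continuous := by fun_prop
  bound := ⟨‖ℓ‖, norm_nonneg _, ℓ.le_opNorm⟩

theorem IsSublinear.const_mul {f : Vec m → ℝ} (hf : IsSublinear f) {c : ℝ} (hc : 0 ≤ c) :
    IsSublinear fun x => c * f x where
  nonneg x := mul_nonneg hc (hf.nonneg x)
  add_le x y := by rw [← mul_add]; exact mul_le_mul_of_nonneg_left (hf.add_le x y) hc
  smul t x ht := by rw [hf.smul t x ht]; ring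
  continuous := hf.continuous.const_mul c |>.congr fun _ => rfl
  bound := by
    obtain ⟨C, hC, h⟩ := hf.bound
    exact ⟨c * C, by positivity, fun x => by
      rw [mul_assoc]; exact mul_le_mul_of_nonneg_left (h x) hc⟩

theorem IsSublinear.sum {ι : Type*} (S : Finset ι) {f : ι → Vec m → ℝ}
    (hf : ∀ i ∈ S, IsSublinear (f i)) : IsSublinear fun x => ∑ i ∈ S, f i x where
  nonneg x := Finset.sum_nonneg fun i hi => (hf i hi).nonneg x
  add_le x y := by
    rw [← Finset.sum_add_distrib]; exact Finset.sum_le_sum fun i hi => (hf i hi).add_le x y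
  smul t x ht := by
    rw [Finset.mul_sum]; exact Finset.sum_congr rfl fun i hi => (hf i hi).smul t x ht
  continuous := continuous_finsetSum S fun i hi => (hf i hi).continuous
  bound := by
    classical
    induction S using Finset.induction_on with
    | empty => exact ⟨0, le_rfl, by simp⟩
    | insert i S hi ih =>
      obtain ⟨C, hC, h⟩ := (hf i (Finset.mem_insert_self i S)).bound
      obtain ⟨C', hC', h'⟩ := ih fun j hj => hf j (Finset.mem_insert_of_mem hj)
      refine ⟨C + C', by positivity, fun x => ?_⟩
      rw [Finset.sum_insert hi, add_mul]
      exact add_le_add (h x) (h' x)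

variable {f : Vec m → ℝ}

theorem IsSublinear.convexOn (hf : IsSublinear f) : ConvexOn ℝ Set.univ f := by
  refine ⟨convex_univ, fun x _ y _ a b ha hb _ => ?_⟩
  have := hf.add_le (a • x) (b • y)
  rwa [hf.smul a x ha, hf.smul b y hb] at this

theorem IsSublinear.zero (hf : IsSublinear f) : f 0 = 0 := by
  have := hf.smul 0 0 le_rfl
  simpa using this

theorem IsSublinear.inner_le (hf : IsSublinear f) {x v : Vec m} (h : v ∈ subdiff f x) (d : Vec m) :
    inner ℝ v d ≤ f d := by
  have h1 := h (x + d)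
  rw [add_sub_cancel_left] at h1
  linarith [hf.add_le x d]

theorem IsSublinear.inner_eq (hf : IsSublinear f) {x v : Vec m} (h : v ∈ subdiff f x) :
    inner ℝ v x = f x := by
  have h1 := h 0
  rw [zero_sub, inner_neg_right, hf.zero] at h1
  linarith [hf.inner_le h x]

theorem mem_subdiff_of_inner_le {x v : Vec m} (h1 : ∀ d, inner ℝ v d ≤ f d)
    (h2 : f x ≤ inner ℝ v x) : v ∈ subdiff f x := by
  intro z
  rw [inner_sub_right]
  linarith [h1 z]

theorem IsSublinear.mem_subdiff_smul (hf : IsSublinear f) {x v : Vec m} (h : v ∈ subdiff f x)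
    {c : ℝ} (hc : 0 ≤ c) : v ∈ subdiff f (c • x) :=
  mem_subdiff_of_inner_le (hf.inner_le h) (by rw [hf.smul c x hc, inner_smul_right, hf.inner_eq h])

theorem IsSublinear.exists_norm_le (hf : IsSublinear f) :
    ∃ C, 0 ≤ C ∧ ∀ x v, v ∈ subdiff f x → ‖v‖ ≤ C := by
  obtain ⟨C, hC, h⟩ := hf.bound
  refine ⟨C, hC, fun x v hv => ?_⟩
  have h1 := (hf.inner_le hv v).trans (h v)
  rw [real_inner_self_eq_norm_sq] at h1
  by_contra! hlt
  nlinarith [norm_nonneg v]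

end Subdiff

/-! ### The loss, the regularizer, and matrix-vector products -/

theorem isSublinear_rankLoss {n : ℕ} : IsSublinear (rankLoss (n := n)) := by
  have h0 : 0 ≤ 1 / ((n : ℝ) * ((n : ℝ) - 1)) := by
    rcases n with _ | n
    · simp
    · push_cast; rw [add_sub_cancel_right]; positivity
  refine IsSublinear.const_mul (IsSublinear.sum _ fun i _ => IsSublinear.sum _ fun j _ => ?_) h0
  exact isSublinear_norm (EuclideanSpace.proj i - EuclideanSpace.proj j : Vec n →L[ℝ] ℝ)

/-- Restriction to a group, extended by zero. -/
def restrict {p g : ℕ} (grp : Fin p → Fin g) (l : Fin g) : Vec p →L[ℝ] Vec p :=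
  LinearMap.toContinuousLinearMap
    { toFun := fun β => WithLp.toLp 2 fun j => if grp j = l then β j else 0
      map_add' := fun x y => by ext j; by_cases h : grp j = l <;> simp [h]
      map_smul' := fun c x => by ext j; by_cases h : grp j = l <;> simp [h] }

theorem norm_restrict {p g : ℕ} (grp : Fin p → Fin g) (l : Fin g) (β : Vec p) :
    ‖restrict grp l β‖
      = Real.sqrt (∑ j ∈ Finset.univ.filter (fun j => grp j = l), β j ^ 2) := by
  rw [EuclideanSpace.norm_eq, Finset.sum_filter]
  congr 1
  refine Finset.sum_congr rfl fun j _ => ?_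
  by_cases h : grp j = l <;> simp [restrict, h]

namespace Problem

variable {n p g : ℕ} (P : Problem n p g)

theorem isSublinear_reg : IsSublinear P.reg := by
  refine IsSublinear.sum _ fun l _ => IsSublinear.const_mul ?_ (P.weight_pos l).le
  simp_rw [← norm_restrict]
  exact isSublinear_norm _

theorem isSublinear_lam_reg : IsSublinear fun β => P.lam * P.reg β :=
  P.isSublinear_reg.const_mul P.lam_pos.le

theorem exists_norm_le_reg : ∃ C, 0 ≤ C ∧ ∀ β, ‖β‖ ≤ C * (P.lam * P.reg β) := by
  refine ⟨P.lam⁻¹ * ∑ j, (P.weight (P.group j))⁻¹, ?_, fun β => ?_⟩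
  · exact mul_nonneg (inv_nonneg.2 P.lam_pos.le)
      (Finset.sum_nonneg fun j _ => inv_nonneg.2 (P.weight_pos _).le)
  have h1 : ‖β‖ ≤ ∑ j, |β j| := by
    rw [EuclideanSpace.norm_eq, Real.sqrt_le_iff]
    refine ⟨Finset.sum_nonneg fun _ _ => abs_nonneg _, ?_⟩
    simp only [Real.norm_eq_abs]
    exact Finset.sum_sq_le_sq_sum_of_nonneg fun _ _ => abs_nonneg _
  have h2 : ∀ j, |β j| ≤ (P.weight (P.group j))⁻¹ * P.reg β := by
    intro j
    rw [le_inv_mul_iff₀ (P.weight_pos _)]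
    have h3 : |β j| ≤ Real.sqrt
        (∑ i ∈ Finset.univ.filter (fun i => P.group i = P.group j), β i ^ 2) := by
      refine Real.le_sqrt_of_sq_le ?_
      rw [sq_abs]
      exact Finset.single_le_sum (f := fun i => β i ^ 2) (fun i _ => sq_nonneg _) (by simp)
    refine (mul_le_mul_of_nonneg_left h3 (P.weight_pos _).le).trans ?_
    exact Finset.single_le_sum (f := fun l => P.weight l *
      Real.sqrt (∑ i ∈ Finset.univ.filter (fun i => P.group i = l), β i ^ 2))
      (fun l _ => mul_nonneg (P.weight_pos l).le (Real.sqrt_nonneg _)) (Finset.mem_univ _)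
  calc ‖β‖ ≤ ∑ j, (P.weight (P.group j))⁻¹ * P.reg β :=
        h1.trans (Finset.sum_le_sum fun j _ => h2 j)
    _ = P.lam⁻¹ * (∑ j, (P.weight (P.group j))⁻¹) * (P.lam * P.reg β) := by
        rw [← Finset.sum_mul]; field_simp [P.lam_pos.ne']

end Problem

section MulVec

variable {m q : ℕ}

/-- `mulVecE` as a continuous linear map. -/
def mulVecL (A : Matrix (Fin m) (Fin q) ℝ) : Vec q →L[ℝ] Vec m :=
  LinearMap.toContinuousLinearMap
    { toFun := mulVecE A
      map_add' := fun x y => by ext j; simp [mulVecE, Matrix.mulVec_add]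
      map_smul' := fun c x => by ext j; simp [mulVecE, Matrix.mulVec_smul] }

theorem mulVecE_eq (A : Matrix (Fin m) (Fin q) ℝ) (v : Vec q) : mulVecE A v = mulVecL A v := rfl

theorem inner_mulVecL (A : Matrix (Fin m) (Fin q) ℝ) (v : Vec q) (w : Vec m) :
    inner ℝ (mulVecL A v) w = inner ℝ v (mulVecL A.transpose w) := by
  simp only [← mulVecE_eq, mulVecE, EuclideanSpace.inner_eq_star_dotProduct, star_trivial]
  rw [Matrix.mulVec_transpose, dotProduct_comm, ← Matrix.dotProduct_mulVec, dotProduct_comm,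
    dotProduct_comm]

end MulVec

/-! ### The operator of the Lagrangian -/

namespace Problem

variable {n p g : ℕ} (P : Problem n p g)

theorem mem_kktOp {z v : Point n p} : v ∈ P.kktOp z ↔
    v.1 = P.y + z.2.1 - mulVecL P.X z.2.2 ∧ v.2.1 + z.1 ∈ subdiff rankLoss z.2.1 ∧
      v.2.2 - mulVecL P.X.transpose z.1 ∈ subdiff (fun β => P.lam * P.reg β) z.2.2 := Iff.rfl

theorem kktOp_mono {z z' v v' : Point n p} (h : v ∈ P.kktOp z) (h' : v' ∈ P.kktOp z') :
    (0 : ℝ) ≤ inner ℝ (v.1 - v'.1) (z.1 - z'.1) + inner ℝ (v.2.1 - v'.2.1) (z.2.1 - z'.2.1)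
      + inner ℝ (v.2.2 - v'.2.2) (z.2.2 - z'.2.2) := by
  obtain ⟨h1, h2, h3⟩ := P.mem_kktOp.1 h
  obtain ⟨h1', h2', h3'⟩ := P.mem_kktOp.1 h'
  have e2 := subdiff_mono h2 h2'
  have e3 := subdiff_mono h3 h3'
  have r1 : v.1 - v'.1 = (z.2.1 - z'.2.1) - mulVecL P.X (z.2.2 - z'.2.2) := by
    rw [h1, h1', map_sub]; abel
  have r2 : v.2.1 + z.1 - (v'.2.1 + z'.1) = (v.2.1 - v'.2.1) + (z.1 - z'.1) := by abel
  have r3 : v.2.2 - mulVecL P.X.transpose z.1 - (v'.2.2 - mulVecL P.X.transpose z'.1)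
      = (v.2.2 - v'.2.2) - mulVecL P.X.transpose (z.1 - z'.1) := by rw [map_sub]; abel
  rw [r2, inner_add_left] at e2
  rw [r3, inner_sub_left, real_inner_comm _ (mulVecL P.X.transpose _), ← inner_mulVecL] at e3
  rw [r1, inner_sub_left]
  rw [real_inner_comm (z.2.1 - z'.2.1) (z.1 - z'.1)] at e2
  linarith

theorem isClosed_kktOp : IsClosed {q : Point n p × Point n p | q.2 ∈ P.kktOp q.1} := by
  have h1 : IsClosed {q : Point n p × Point n p |
      q.2.1 = P.y + q.1.2.1 - mulVecL P.X q.1.2.2} := isClosed_eq (by fun_prop) (by fun_prop)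
  have h2 : IsClosed {q : Point n p × Point n p |
      q.2.2.1 + q.1.1 ∈ subdiff rankLoss q.1.2.1} :=
    (isClosed_subdiff (isSublinear_rankLoss (n := n)).continuous).preimage
      (f := fun q : Point n p × Point n p => (q.1.2.1, q.2.2.1 + q.1.1)) (by fun_prop)
  have h3 : IsClosed {q : Point n p × Point n p |
      q.2.2.2 - mulVecL P.X.transpose q.1.1 ∈ subdiff (fun β => P.lam * P.reg β) q.1.2.2} :=
    (isClosed_subdiff P.isSublinear_lam_reg.continuous).preimage
      (f := fun q : Point n p × Point n p =>
        (q.1.2.2, q.2.2.2 - mulVecL P.X.transpose q.1.1)) (by fun_prop)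
  exact h1.inter (h2.inter h3)

/-- The resolvents of the weighted operator are everywhere defined. -/
theorem exists_resolvent {τ σ : ℝ} (hτ : 0 < τ) (hσ : 0 < σ) (a : Point n p) :
    ∃ z : Point n p, (((τ * σ⁻¹) • (a.1 - z.1), σ⁻¹ • (a.2.1 - z.2.1), σ⁻¹ • (a.2.2 - z.2.2)) :
      Point n p) ∈ P.kktOp z := by
  have hL := isSublinear_rankLoss (n := n)
  have hR := P.isSublinear_lam_reg
  have hLc := hL.continuous
  have hRc : Continuous P.reg := P.isSublinear_reg.continuous
  obtain ⟨⟨s, β⟩, hmin⟩ := Continuous.exists_forall_le (β := Vec n × Vec p)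
    (f := fun x => rankLoss x.1 + P.lam * P.reg x.2
      + ((2 * σ)⁻¹ * (‖x.1 - a.2.1‖ ^ 2 + ‖x.2 - a.2.2‖ ^ 2)
        + σ / (2 * τ) * ‖P.y + x.1 - mulVecL P.X x.2 - (τ / σ) • a.1‖ ^ 2)) (by fun_prop) (by
      have h1 : Tendsto (fun x : Vec n × Vec p => (2 * σ)⁻¹ * dist x a.2 ^ 2)
          (cocompact _) atTop :=
        ((tendsto_pow_atTop two_ne_zero).comp
          (tendsto_dist_right_cocompact_atTop a.2)).const_mul_atTop (by positivity)
      refine tendsto_atTop_mono (fun x => ?_) h1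
      have h2 : dist x a.2 ^ 2 ≤ ‖x.1 - a.2.1‖ ^ 2 + ‖x.2 - a.2.2‖ ^ 2 := by
        rw [Prod.dist_eq, dist_eq_norm, dist_eq_norm]
        rcases max_choice ‖x.1 - a.2.1‖ ‖x.2 - a.2.2‖ with h | h <;> rw [h]
        · linarith [sq_nonneg ‖x.2 - a.2.2‖]
        · linarith [sq_nonneg ‖x.1 - a.2.1‖]
      have h3 := hL.nonneg x.1
      have h4 := hR.nonneg x.2
      have h5 : 0 ≤ σ / (2 * τ) * ‖P.y + x.1 - mulVecL P.X x.2 - (τ / σ) • a.1‖ ^ 2 := by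
        positivity
      have h6 := mul_le_mul_of_nonneg_left h2 (by positivity : 0 ≤ (2 * σ)⁻¹)
      linarith)
  set r := P.y + s - mulVecL P.X β - (τ / σ) • a.1 with hr
  have hs : -(σ⁻¹ • (s - a.2.1) + (σ / τ) • r) ∈ subdiff rankLoss s := by
    refine neg_mem_subdiff_of_isMin (q := fun s' => (2 * σ)⁻¹ * ‖s' - a.2.1‖ ^ 2
      + σ / (2 * τ) * ‖P.y + s' - mulVecL P.X β - (τ / σ) • a.1‖ ^ 2)
      (C := fun d => ((2 * σ)⁻¹ + σ / (2 * τ)) * ‖d‖ ^ 2) hL.convexOn (fun d t => ?_) fun z => ?_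
    · have e1 : s + t • d - a.2.1 = (s - a.2.1) + t • d := by abel
      have e2 : P.y + (s + t • d) - mulVecL P.X β - (τ / σ) • a.1 = r + t • d := by
        rw [hr]; abel
      rw [e1, e2, ← hr, norm_add_sq_real, norm_add_sq_real, inner_smul_right, inner_smul_right,
        norm_smul, mul_pow, Real.norm_eq_abs, sq_abs, inner_add_left, inner_smul_left,
        inner_smul_left]
      simp only [conj_trivial]
      field_simp
      ring
    · have := hmin (z, β)
      simp only at this
      linarith
  have hβ : -(σ⁻¹ • (β - a.2.2) - (σ / τ) • mulVecL P.X.transpose r)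
      ∈ subdiff (fun β => P.lam * P.reg β) β := by
    refine neg_mem_subdiff_of_isMin (q := fun β' => (2 * σ)⁻¹ * ‖β' - a.2.2‖ ^ 2
      + σ / (2 * τ) * ‖P.y + s - mulVecL P.X β' - (τ / σ) • a.1‖ ^ 2)
      (C := fun d => (2 * σ)⁻¹ * ‖d‖ ^ 2 + σ / (2 * τ) * ‖mulVecL P.X d‖ ^ 2) hR.convexOn
      (fun d t => ?_) fun z => ?_
    · have e1 : β + t • d - a.2.2 = (β - a.2.2) + t • d := by abel
      have e2 : P.y + s - mulVecL P.X (β + t • d) - (τ / σ) • a.1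
          = r - t • mulVecL P.X d := by
        rw [hr, map_add, map_smul]; abel
      rw [e1, e2, ← hr, norm_add_sq_real, norm_sub_sq_real r, inner_smul_right, inner_smul_right,
        norm_smul, norm_smul, mul_pow, mul_pow, Real.norm_eq_abs, sq_abs,
        inner_sub_left (σ⁻¹ • (β - a.2.2)), inner_smul_left, inner_smul_left, real_inner_comm d (mulVecL P.X.transpose r),
        ← inner_mulVecL, real_inner_comm r]
      simp only [conj_trivial]
      field_simp
      ring
    · have := hmin (s, z)
      simp only at this
      linarith
  have hw : a.1 - (σ / τ) • (P.y + s - mulVecL P.X β) = -((σ / τ) • r) := by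
    rw [hr, smul_sub _ _ ((τ / σ) • a.1), smul_smul]
    have : σ / τ * (τ / σ) = 1 := by field_simp
    rw [this, one_smul, neg_sub]
  refine ⟨(a.1 - (σ / τ) • (P.y + s - mulVecL P.X β), s, β), P.mem_kktOp.2 ⟨?_, ?_, ?_⟩⟩
  · simp only [sub_sub_cancel]
    rw [smul_smul]
    have : τ * σ⁻¹ * (σ / τ) = 1 := by field_simp
    rw [this, one_smul]
  · simp only
    rw [hw]
    convert hs using 1
    rw [neg_add, ← smul_neg σ⁻¹, neg_sub s]
  · simp only
    rw [hw]
    convert hβ using 1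
    rw [map_neg, map_smul, neg_sub, ← neg_sub a.2.2 β, smul_neg]
    abel

theorem kktSet_nonempty : P.kktSet.Nonempty := by
  have hL := isSublinear_rankLoss (n := n)
  have hR := P.isSublinear_lam_reg
  obtain ⟨C, hC0, hC⟩ := hL.exists_norm_le
  obtain ⟨D, hD0, hD⟩ := P.exists_norm_le_reg
  have hex : ∀ k : ℕ, ∃ z : Point n p, ((((k : ℝ) + 1)⁻¹) • (-z) : Point n p) ∈ P.kktOp z := by
    intro k
    obtain ⟨z, hz⟩ := P.exists_resolvent one_pos (by positivity : (0 : ℝ) < (k : ℝ) + 1) 0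
    exact ⟨z, by convert hz using 1; simp [Prod.ext_iff]⟩
  choose z hz using hex
  set B := rankLoss (-P.y) + ‖P.y‖ ^ 2 with hB
  have hB0 : 0 ≤ B := add_nonneg (hL.nonneg _) (sq_nonneg _)
  set S := ‖P.y‖ + ‖mulVecL P.X‖ * (D * B) + (B + 1) with hS
  have hbound : ∀ k, ‖z k‖ ≤ max (C + S) (max S (D * B)) := by
    intro k
    obtain ⟨h1, h2, h3⟩ := P.mem_kktOp.1 (hz k)
    set ε := ((k : ℝ) + 1)⁻¹ with hε
    have hε0 : 0 < ε := by positivity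
    have hε1 : ε ≤ 1 := inv_le_one_of_one_le₀ (by linarith [Nat.cast_nonneg (α := ℝ) k])
    generalize hw' : (z k).1 = w' at *
    generalize hs' : (z k).2.1 = s' at *
    generalize hβ' : (z k).2.2 = β' at *
    simp only [Prod.smul_fst, Prod.smul_snd, Prod.fst_neg, Prod.snd_neg, hw', hs', hβ'] at h1 h2 h3
    have e1 := hL.inner_le h2 (-P.y)
    have e2 := hL.inner_eq h2
    have e3 := hR.inner_eq h3
    have e4 : mulVecL P.X β' = P.y + s' + ε • w' := by
      have : P.y + s' = ε • -w' + mulVecL P.X β' := by rw [h1]; abel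
      rw [this, smul_neg]; abel
    rw [inner_sub_left, real_inner_comm β' (mulVecL P.X.transpose w'), ← inner_mulVecL, e4,
      inner_add_left, inner_add_left, inner_smul_left, inner_smul_left, inner_neg_left,
      real_inner_self_eq_norm_sq, real_inner_self_eq_norm_sq] at e3
    rw [inner_add_left, inner_smul_left, inner_neg_left, real_inner_self_eq_norm_sq] at e2
    rw [inner_add_left, inner_smul_left, inner_neg_left, inner_neg_right, inner_neg_right,
      real_inner_comm P.y w'] at e1
    simp only [conj_trivial] at e1 e2 e3
    rw [real_inner_comm s' w'] at e2
    have e5 := real_inner_le_norm (-s') P.y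
    rw [inner_neg_left, norm_neg] at e5
    have e6 := hL.nonneg s'
    have e7 : P.lam * P.reg β' + ε * ‖w'‖ ^ 2 ≤ B := by
      have h8 : ε * (‖s'‖ * ‖P.y‖) ≤ ε * ‖s'‖ ^ 2 + ε * ‖P.y‖ ^ 2 := by
        rw [← mul_add]
        exact mul_le_mul_of_nonneg_left
          (by nlinarith [sq_nonneg (‖s'‖ - ‖P.y‖), sq_nonneg (‖s'‖ + ‖P.y‖)]) hε0.le
      have h9 : ε * ‖P.y‖ ^ 2 ≤ ‖P.y‖ ^ 2 := mul_le_of_le_one_left (sq_nonneg _) hε1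
      have h10 := mul_le_mul_of_nonneg_left e5 hε0.le
      have h11 : 0 ≤ ε * ‖β'‖ ^ 2 := by positivity
      rw [hB]
      linarith
    have f1 : ‖β'‖ ≤ D * B := (hD β').trans
      (mul_le_mul_of_nonneg_left (by nlinarith [sq_nonneg ‖w'‖]) hD0)
    have f2 : ‖ε • w'‖ ≤ B + 1 := by
      rw [norm_smul, Real.norm_of_nonneg hε0.le]
      have := hR.nonneg β'
      have h8 : (ε * ‖w'‖) ^ 2 ≤ B := by
        have : ε * (ε * ‖w'‖ ^ 2) ≤ 1 * B :=
          mul_le_mul hε1 (by linarith) (by positivity) zero_le_one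
        nlinarith
      nlinarith [sq_nonneg (ε * ‖w'‖ - 1)]
    have f3 : ‖s'‖ ≤ S := by
      have h8 : s' = -P.y + mulVecL P.X β' - ε • w' := by rw [e4]; abel
      rw [h8]
      refine (norm_sub_le _ _).trans (add_le_add ((norm_add_le _ _).trans ?_) f2)
      rw [norm_neg]
      exact add_le_add le_rfl (((mulVecL P.X).le_opNorm _).trans
        (mul_le_mul_of_nonneg_left f1 (norm_nonneg _)))
    have f4 : ‖w'‖ ≤ C + S := by
      have h8 : w' = (ε • -s' + w') + ε • s' := by rw [smul_neg]; abel
      rw [h8]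
      refine (norm_add_le _ _).trans (add_le_add (hC _ _ h2) ?_)
      rw [norm_smul, Real.norm_of_nonneg hε0.le]
      exact (mul_le_of_le_one_left (norm_nonneg _) hε1).trans f3
    rw [Prod.norm_def, Prod.norm_def, hw', hs', hβ']
    exact max_le_max f4 (max_le_max f3 f1)
  have hbdd : Bornology.IsBounded (Set.range z) :=
    isBounded_iff_forall_norm_le.2 ⟨_, by rintro _ ⟨k, rfl⟩; exact hbound k⟩
  obtain ⟨z', -, φ, hφ, hlim⟩ := tendsto_subseq_of_bounded hbdd (fun k => Set.mem_range_self k)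
  refine ⟨z', ?_⟩
  have h1 : Tendsto (fun k => (((φ k : ℕ) : ℝ) + 1)⁻¹ • (-z (φ k))) atTop (𝓝 ((0 : ℝ) • -z')) := by
    refine Tendsto.smul ?_ hlim.neg
    exact (tendsto_inv_atTop_zero.comp
      (tendsto_atTop_add_const_right _ 1 tendsto_natCast_atTop_atTop)).comp hφ.tendsto_atTop
  rw [zero_smul] at h1
  exact P.isClosed_kktOp.mem_of_tendsto (hlim.prodMk_nhds h1)
    (Eventually.of_forall fun k => hz (φ k))

variable {P}

theorem mem_kktSet {z : Point n p} : z ∈ P.kktSet ↔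
    P.y + z.2.1 - mulVecL P.X z.2.2 = 0 ∧ z.1 ∈ subdiff rankLoss z.2.1 ∧
      -mulVecL P.X.transpose z.1 ∈ subdiff (fun β => P.lam * P.reg β) z.2.2 := by
  rw [kktSet, Set.mem_ofPred_eq, mem_kktOp]
  simp only [Prod.fst_zero, Prod.snd_zero, zero_add, zero_sub, eq_comm]

theorem isPrimalOptimal_of_mem_kktSet {z : Point n p} (hz : z ∈ P.kktSet) :
    P.IsPrimalOptimal z.2.1 z.2.2 := by
  obtain ⟨h1, h2, h3⟩ := mem_kktSet.1 hz
  have e1 : mulVecL P.X z.2.2 = P.y + z.2.1 := (sub_eq_zero.1 h1).symm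
  refine ⟨by rw [mulVecE_eq, e1]; abel, fun s' β' h => ?_⟩
  rw [mulVecE_eq] at h
  have e2 : mulVecL P.X β' = P.y + s' := by
    have := sub_eq_zero.1 h
    rw [← this]; abel
  have h4 := h2 s'
  have h5 := h3 β'
  rw [inner_neg_left, real_inner_comm, ← inner_mulVecL, map_sub, e1, e2,
    add_sub_add_left_eq_sub, real_inner_comm] at h5
  linarith

theorem le_conj {m : ℕ} (f : Vec m → ℝ) (v x : Vec m) :
    ((inner ℝ v x - f x : ℝ) : EReal) ≤ conj f v :=
  le_iSup (fun x : Vec m => ((inner ℝ v x - f x : ℝ) : EReal)) x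

theorem conj_eq {m : ℕ} {f : Vec m → ℝ} {v x : Vec m} (h : v ∈ subdiff f x) :
    conj f v = ((inner ℝ v x - f x : ℝ) : EReal) := by
  refine le_antisymm (iSup_le fun z => EReal.coe_le_coe_iff.2 ?_) (le_conj f v x)
  have := h z
  rw [inner_sub_right] at this
  linarith

theorem isDualOptimal_of_mem_kktSet {z : Point n p} (hz : z ∈ P.kktSet) :
    P.IsDualOptimal z.1 := by
  obtain ⟨h1, h2, h3⟩ := mem_kktSet.1 hz
  have hX : mulVecL P.X z.2.2 = P.y + z.2.1 := (sub_eq_zero.1 h1).symm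
  have hΨ : -(P.lam⁻¹ • mulVecE P.X.transpose z.1) ∈ subdiff P.reg z.2.2 := by
    have := smul_mem_subdiff (inv_nonneg.2 P.lam_pos.le) h3
    rw [smul_neg] at this
    simp only [inv_mul_cancel_left₀ P.lam_pos.ne'] at this
    exact this
  have key : ∀ w' : Vec n, (inner ℝ P.y w' : ℝ) + (inner ℝ w' z.2.1 - rankLoss z.2.1)
      + P.lam * (inner ℝ (-(P.lam⁻¹ • mulVecE P.X.transpose w')) z.2.2 - P.reg z.2.2)
      = -(rankLoss z.2.1 + P.lam * P.reg z.2.2) := by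
    intro w'
    rw [mulVecE_eq, inner_neg_left, inner_smul_left, real_inner_comm z.2.2, ← inner_mulVecL, hX,
      inner_add_left, real_inner_comm w' z.2.1]
    simp only [conj_trivial]
    have := P.lam_pos.ne'
    field_simp
    ring
  have hval : P.dualObj z.1 = ((-(rankLoss z.2.1 + P.lam * P.reg z.2.2) : ℝ) : EReal) := by
    rw [dualObj, conj_eq h2, conj_eq hΨ, ← key z.1]
    push_cast
    rfl
  refine ⟨by rw [hval]; exact EReal.coe_ne_top _, by rw [hval]; exact EReal.coe_ne_bot _,
    fun w' => ?_⟩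
  rw [hval, ← key w', dualObj, EReal.coe_add, EReal.coe_add, EReal.coe_mul]
  have hl : (0 : EReal) ≤ (P.lam : EReal) := EReal.coe_nonneg.2 P.lam_pos.le
  exact add_le_add (add_le_add le_rfl (le_conj _ _ _))
    (mul_le_mul_of_nonneg_left (le_conj _ _ _) hl)

end Problem

/-! ### The operator in weighted coordinates -/

/-- Primal-dual points with the Euclidean norm. -/
abbrev Scaled (n p : ℕ) : Type := WithLp 2 (Vec n × WithLp 2 (Vec n × Vec p))

section Scale

variable {n p g : ℕ}

/-- The coordinates `(√τ w, s, β)`, in which the weighted norm is Euclidean. -/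
def scale (τ : ℝ) (z : Point n p) : Scaled n p :=
  WithLp.toLp 2 (Real.sqrt τ • z.1, WithLp.toLp 2 (z.2.1, z.2.2))

/-- The inverse of `scale`. -/
def unscale (τ : ℝ) (h : Scaled n p) : Point n p :=
  ((Real.sqrt τ)⁻¹ • h.fst, h.snd.fst, h.snd.snd)

theorem unscale_scale {τ : ℝ} (hτ : 0 < τ) (z : Point n p) : unscale τ (scale τ z) = z := by
  have := (Real.sqrt_pos.2 hτ).ne'
  simp [unscale, scale, smul_smul, this]

theorem scale_unscale {τ : ℝ} (hτ : 0 < τ) (h : Scaled n p) : scale τ (unscale τ h) = h := by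
  have := (Real.sqrt_pos.2 hτ).ne'
  simp only [unscale, scale, smul_smul, mul_inv_cancel₀ this, one_smul]
  rfl

@[simp] theorem scale_fst (τ : ℝ) (z : Point n p) : (scale τ z).fst = Real.sqrt τ • z.1 := rfl

@[simp] theorem scale_snd_fst (τ : ℝ) (z : Point n p) : (scale τ z).snd.fst = z.2.1 := rfl

@[simp] theorem scale_snd_snd (τ : ℝ) (z : Point n p) : (scale τ z).snd.snd = z.2.2 := rfl

theorem norm_scale {τ : ℝ} (hτ : 0 ≤ τ) (z : Point n p) : ‖scale τ z‖ = wnorm τ z := by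
  rw [wnorm, eq_comm, Real.sqrt_eq_iff_eq_sq (by positivity) (norm_nonneg _),
    WithLp.prod_norm_sq_eq_of_L2, WithLp.prod_norm_sq_eq_of_L2]
  simp only [scale_fst, scale_snd_fst, scale_snd_snd, norm_smul, mul_pow, Real.norm_eq_abs, sq_abs, Real.sq_sqrt hτ]
  ring

theorem scale_sub (τ : ℝ) (z z' : Point n p) : scale τ (z - z') = scale τ z - scale τ z' := by
  simp only [scale, Prod.fst_sub, Prod.snd_sub, smul_sub]
  rfl

theorem scale_zero (τ : ℝ) : scale τ (0 : Point n p) = 0 := by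
  simp [scale]

theorem continuous_unscale (τ : ℝ) : Continuous (unscale (n := n) (p := p) τ) := by
  unfold unscale; fun_prop

theorem unscale_zero (τ : ℝ) : unscale τ (0 : Scaled n p) = 0 := by
  simp [unscale]

theorem wdist_eq_infDist {τ : ℝ} (hτ : 0 ≤ τ) (z : Point n p) (S : Set (Point n p)) :
    wdist τ z S = Metric.infDist (scale τ z) (scale τ '' S) := by
  rw [Metric.infDist_eq_iInf, ← sInf_image', Set.image_image, wdist]
  simp_rw [dist_eq_norm, ← scale_sub, norm_scale hτ]

theorem wnorm_le_sqrt_max_mul {τ : ℝ} (z : Point n p) :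
    wnorm τ z ≤ Real.sqrt (max 1 τ) * wnorm 1 z := by
  rw [wnorm, wnorm, ← Real.sqrt_mul (by positivity)]
  refine Real.sqrt_le_sqrt ?_
  have h1 := mul_le_mul_of_nonneg_right (le_max_left 1 τ) (sq_nonneg ‖z.2.1‖)
  have h2 := mul_le_mul_of_nonneg_right (le_max_left 1 τ) (sq_nonneg ‖z.2.2‖)
  have h3 := mul_le_mul_of_nonneg_right (le_max_right 1 τ) (sq_nonneg ‖z.1‖)
  linarith

theorem wnorm_one_le_sqrt_max_mul {τ : ℝ} (hτ : 0 < τ) (z : Point n p) :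
    wnorm 1 z ≤ Real.sqrt (max 1 τ) * wnorm τ⁻¹ z := by
  rw [wnorm, wnorm, ← Real.sqrt_mul (by positivity)]
  refine Real.sqrt_le_sqrt ?_
  have h1 := mul_le_mul_of_nonneg_right (le_max_left 1 τ) (sq_nonneg ‖z.2.1‖)
  have h2 := mul_le_mul_of_nonneg_right (le_max_left 1 τ) (sq_nonneg ‖z.2.2‖)
  have h3 := mul_le_mul_of_nonneg_right (le_max_right 1 τ)
    (mul_nonneg (inv_nonneg.2 hτ.le) (sq_nonneg ‖z.1‖))
  rw [mul_inv_cancel_left₀ hτ.ne'] at h3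
  linarith

theorem wnorm_nonneg (τ : ℝ) (z : Point n p) : 0 ≤ wnorm τ z := Real.sqrt_nonneg _

theorem wdist_le_wnorm (τ : ℝ) (z : Point n p) {S : Set (Point n p)} {u : Point n p}
    (hu : u ∈ S) : wdist τ z S ≤ wnorm τ (z - u) :=
  csInf_le ⟨0, by rintro _ ⟨v, -, rfl⟩; exact wnorm_nonneg _ _⟩ ⟨u, hu, rfl⟩

theorem wdist_nonneg (τ : ℝ) (z : Point n p) (S : Set (Point n p)) : 0 ≤ wdist τ z S :=
  Real.sInf_nonneg (by rintro _ ⟨v, -, rfl⟩; exact wnorm_nonneg _ _)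

theorem wdist_le_sqrt_max_mul {τ : ℝ} (z : Point n p) {S : Set (Point n p)} (hS : S.Nonempty) :
    wdist τ z S ≤ Real.sqrt (max 1 τ) * eucDist z S := by
  have h0 : 0 < Real.sqrt (max 1 τ) := Real.sqrt_pos.2 (by positivity)
  rw [← inv_mul_le_iff₀ h0]
  refine le_csInf (hS.image _) ?_
  rintro _ ⟨u, hu, rfl⟩
  rw [inv_mul_le_iff₀ h0]
  exact (wdist_le_wnorm τ z hu).trans (wnorm_le_sqrt_max_mul _)

/-- The operator of the Lagrangian in weighted coordinates. -/
def Problem.scaledOp (P : Problem n p g) (τ : ℝ) (h : Scaled n p) : Set (Scaled n p) :=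
  {u | unscale τ⁻¹ u ∈ P.kktOp (unscale τ h)}

variable (P : Problem n p g)

theorem Problem.mem_scaledOp_scale {τ : ℝ} (hτ : 0 < τ) {z : Point n p} {u : Scaled n p} :
    u ∈ P.scaledOp τ (scale τ z) ↔ unscale τ⁻¹ u ∈ P.kktOp z := by
  rw [scaledOp, Set.mem_ofPred_eq, unscale_scale hτ]

theorem Problem.zeros_scaledOp {τ : ℝ} (hτ : 0 < τ) :
    {h | (0 : Scaled n p) ∈ P.scaledOp τ h} = scale τ '' P.kktSet := by
  ext h
  rw [Set.mem_ofPred_eq, scaledOp, Set.mem_ofPred_eq, unscale_zero]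
  constructor
  · intro hh
    exact ⟨_, hh, scale_unscale hτ h⟩
  · rintro ⟨z, hz, rfl⟩
    rw [unscale_scale hτ]
    exact hz

theorem Problem.zeros_scaledOp_nonempty {τ : ℝ} (hτ : 0 < τ) :
    {h | (0 : Scaled n p) ∈ P.scaledOp τ h}.Nonempty := by
  rw [P.zeros_scaledOp hτ]; exact P.kktSet_nonempty.image _

theorem Problem.infDist_scale {τ : ℝ} (hτ : 0 < τ) (z : Point n p) :
    Metric.infDist (scale τ z) {h | (0 : Scaled n p) ∈ P.scaledOp τ h} = wdist τ z P.kktSet := by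
  rw [P.zeros_scaledOp hτ, wdist_eq_infDist hτ.le]

theorem Problem.isMaxMonotone_scaledOp {τ : ℝ} (hτ : 0 < τ) : IsMaxMonotone (P.scaledOp τ) where
  mono x x' v v' h h' := by
    have := P.kktOp_mono h h'
    have hs := (Real.sqrt_pos.2 hτ).ne'
    simp only [unscale, Real.sqrt_inv, inv_inv] at this
    rw [← smul_sub, ← smul_sub, inner_smul_left, inner_smul_right] at this
    simp only [conj_trivial, mul_inv_cancel_left₀ hs] at this
    simp only [WithLp.prod_inner_apply, WithLp.ofLp_sub, Prod.fst_sub, Prod.snd_sub]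
    linarith!
  closed := P.isClosed_kktOp.preimage
    (f := fun q : Scaled n p × Scaled n p => (unscale τ q.1, unscale τ⁻¹ q.2))
    (((continuous_unscale τ).comp continuous_fst).prodMk
      ((continuous_unscale τ⁻¹).comp continuous_snd))
  range c hc a := by
    obtain ⟨z, hz⟩ := P.exists_resolvent hτ hc (unscale τ a)
    refine ⟨scale τ z, (P.mem_scaledOp_scale hτ).2 ?_⟩
    convert hz using 1
    have hs := (Real.sqrt_pos.2 hτ).ne'
    refine Prod.ext ?_ (Prod.ext ?_ ?_)
    · simp only [unscale, Real.sqrt_inv, inv_inv, scale_fst, WithLp.smul_fst, WithLp.sub_fst]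
      have : a.fst - Real.sqrt τ • z.1 = Real.sqrt τ • ((Real.sqrt τ)⁻¹ • a.fst - z.1) := by
        rw [smul_sub, smul_smul, mul_inv_cancel₀ hs, one_smul]
      rw [this, smul_smul, smul_smul]
      congr 1
      rw [mul_right_comm, Real.mul_self_sqrt hτ.le]
    · simp [unscale]
    · simp [unscale]

end Scale

/-! ### The steps of the algorithm -/

section Step

variable {m : ℕ}

theorem inner_sub_prox_le {σ : ℝ} (hσ : 0 < σ) (s a v : Vec m) :
    inner ℝ v a - 1 / (2 * σ) * ‖v - s‖ ^ 2 ≤ inner ℝ s a + σ / 2 * ‖a‖ ^ 2 := by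
  have h := sq_nonneg ‖(v - s) - σ • a‖
  rw [norm_sub_sq_real, inner_smul_right, norm_smul, mul_pow, Real.norm_eq_abs, sq_abs,
    inner_sub_left] at h
  have h2 : 0 ≤ 1 / (2 * σ) * (‖v - s‖ ^ 2 - 2 * (σ * (inner ℝ v a - inner ℝ s a))
      + σ ^ 2 * ‖a‖ ^ 2) := mul_nonneg (by positivity) h
  have h3 : 1 / (2 * σ) * (‖v - s‖ ^ 2 - 2 * (σ * (inner ℝ v a - inner ℝ s a))
      + σ ^ 2 * ‖a‖ ^ 2) = 1 / (2 * σ) * ‖v - s‖ ^ 2 - (inner ℝ v a - inner ℝ s a)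
      + σ / 2 * ‖a‖ ^ 2 := by field_simp
  linarith

theorem inner_sub_prox_le_of_mem_subdiff {f : Vec m → ℝ} {σ : ℝ} (hσ : 0 < σ) {s s' a : Vec m}
    (h : σ⁻¹ • (s - s') + a ∈ subdiff f s') (v : Vec m) :
    inner ℝ v a - f v - 1 / (2 * σ) * ‖v - s‖ ^ 2
      ≤ inner ℝ s' a - f s' - 1 / (2 * σ) * ‖s' - s‖ ^ 2 := by
  have h1 := h v
  have h2 : v - s = (v - s') - (s - s') := by abel
  rw [inner_add_left, inner_smul_left, inner_sub_right a, real_inner_comm v a,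
    real_inner_comm s' a] at h1
  simp only [conj_trivial] at h1
  rw [h2, norm_sub_sq_real, norm_sub_rev s' s, real_inner_comm (s - s')]
  have h3 : 0 ≤ 1 / (2 * σ) * ‖v - s'‖ ^ 2 := by positivity
  have h4 : 1 / (2 * σ) * (‖v - s'‖ ^ 2 - 2 * inner ℝ (s - s') (v - s') + ‖s - s'‖ ^ 2)
      = 1 / (2 * σ) * ‖v - s'‖ ^ 2 - σ⁻¹ * inner ℝ (s - s') (v - s')
        + 1 / (2 * σ) * ‖s - s'‖ ^ 2 := by field_simp
  linarith

variable {n p g : ℕ} (P : Problem n p g)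

theorem Problem.lagrangian_eq (w s : Vec n) (β : Vec p) :
    P.lagrangian w s β = inner ℝ P.y w + (inner ℝ s w - rankLoss s)
      + (inner ℝ β (-mulVecL P.X.transpose w) - P.lam * P.reg β) := by
  rw [lagrangian, mulVecE_eq, inner_neg_right]; ring

theorem Problem.bddAbove_lagrangian {σ : ℝ} (hσ : 0 < σ) (w s : Vec n) (β : Vec p) :
    BddAbove (Set.range fun q : Vec n × Vec p =>
      P.lagrangian w q.1 q.2 - 1 / (2 * σ) * ‖q.1 - s‖ ^ 2 - 1 / (2 * σ) * ‖q.2 - β‖ ^ 2) := by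
  refine ⟨inner ℝ P.y w + (inner ℝ s w + σ / 2 * ‖w‖ ^ 2)
    + (inner ℝ β (-mulVecL P.X.transpose w) + σ / 2 * ‖-mulVecL P.X.transpose w‖ ^ 2), ?_⟩
  rintro _ ⟨q, rfl⟩
  have h1 := inner_sub_prox_le hσ s w q.1
  have h2 := inner_sub_prox_le hσ β (-mulVecL P.X.transpose w) q.2
  have h3 := (isSublinear_rankLoss (n := n)).nonneg q.1
  have h4 := P.isSublinear_lam_reg.nonneg q.2
  simp only [P.lagrangian_eq]
  linarith

/-- The gradient of the subproblem objective, at points where it exists. -/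
theorem gradient_subObj_eq {τ σ : ℝ} (hσ : 0 < σ) {w s w' s' G : Vec n} {β β' : Vec p}
    (hs : σ⁻¹ • (s - s') + w' ∈ subdiff rankLoss s')
    (hβ : σ⁻¹ • (β - β') - mulVecL P.X.transpose w' ∈ subdiff (fun β => P.lam * P.reg β) β')
    (hG : HasGradientAt (subObj P τ σ w s β) G w') :
    G = P.y + s' - mulVecL P.X β' + (τ / σ) • (w' - w) := by
  set q := P.y + s' - mulVecL P.X β' with hq
  set c := -rankLoss s' - P.lam * P.reg β' - 1 / (2 * σ) * ‖s' - s‖ ^ 2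
    - 1 / (2 * σ) * ‖β' - β‖ ^ 2 with hc
  have hlag : ∀ v, P.lagrangian v s' β' - 1 / (2 * σ) * ‖s' - s‖ ^ 2
      - 1 / (2 * σ) * ‖β' - β‖ ^ 2 = inner ℝ q v + c := fun v => by
    rw [P.lagrangian_eq, inner_neg_right, ← inner_mulVecL, hq, inner_sub_left, inner_add_left, hc]
    ring
  have hle : ∀ v, inner ℝ q v + c ≤ P.augLagrangian σ v s β := fun v => by
    rw [← hlag]
    exact le_ciSup (P.bddAbove_lagrangian hσ v s β) (s', β')
  have heq : P.augLagrangian σ w' s β = inner ℝ q w' + c := by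
    refine le_antisymm (ciSup_le fun x => ?_) (hle w')
    rw [← hlag]
    have h1 := inner_sub_prox_le_of_mem_subdiff hσ hs x.1
    rw [sub_eq_add_neg] at hβ
    have h2 := inner_sub_prox_le_of_mem_subdiff hσ hβ x.2
    simp only [P.lagrangian_eq]
    linarith
  have hd : HasFDerivAt (fun v => inner ℝ q v + c + τ / (2 * σ) * ‖v - w‖ ^ 2)
      (innerSL ℝ q + (τ / (2 * σ)) • ((2 : ℕ) • (innerSL ℝ (w' - w)).comp
        (ContinuousLinearMap.id ℝ (Vec n)))) w' :=
    ((innerSL ℝ q).hasFDerivAt.add_const c).add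
      (((hasFDerivAt_id w').sub_const w).norm_sq.const_mul (τ / (2 * σ)))
  have hmin : IsLocalMin (fun v => subObj P τ σ w s β v
      - (inner ℝ q v + c + τ / (2 * σ) * ‖v - w‖ ^ 2)) w' := by
    refine Eventually.of_forall fun v => ?_
    simp only [subObj]
    linarith [hle v]
  have h0 := hmin.hasFDerivAt_eq_zero (hG.hasFDerivAt.sub hd)
  refine ext_inner_right ℝ fun d => ?_
  have h1 := DFunLike.congr_fun h0 d
  simp only [ContinuousLinearMap.comp_id, sub_apply,
    InnerProductSpace.toDual_apply_apply, add_apply,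
    smul_apply, innerSL_apply_apply, nsmul_eq_mul, Nat.cast_ofNat,
    smul_eq_mul, zero_apply] at h1
  rw [inner_add_left, inner_smul_left]
  simp only [conj_trivial]
  have h2 : τ / (2 * σ) * (2 * inner ℝ (w' - w) d) = τ / σ * inner ℝ (w' - w) d := by field_simp
  linarith

end Step

section Run

variable {n p g : ℕ} {P : Problem n p g} {τ : ℝ} {σ δ : ℕ → ℝ} {w s : ℕ → Vec n} {β : ℕ → Vec p}

theorem IsPALM.sigma_le (h : IsPALM P τ σ δ w s β) (k : ℕ) : σ 0 ≤ σ k :=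
  monotone_nat_of_le_succ h.sigma_mono (Nat.zero_le k)

theorem IsPALM.sigma_pos' (h : IsPALM P τ σ δ w s β) (k : ℕ) : 0 < σ k :=
  h.sigma_pos.trans_le (h.sigma_le k)

/-- Each step of the algorithm is an inexact proximal point step. -/
theorem IsPALM.exists_step (h : IsPALM P τ σ δ w s β) (k : ℕ) : ∃ a : Scaled n p,
    (σ k)⁻¹ • (a - scale τ (w (k + 1), s (k + 1), β (k + 1)))
      ∈ P.scaledOp τ (scale τ (w (k + 1), s (k + 1), β (k + 1))) ∧
    ‖a - scale τ (w k, s k, β k)‖ ≤ δ k * min 1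
      ‖scale τ (w (k + 1), s (k + 1), β (k + 1)) - scale τ (w k, s k, β k)‖ := by
  have hσ := h.sigma_pos' k
  have hτ := h.tau_pos
  have hlam := P.lam_pos
  have hrt := Real.sqrt_pos.2 hτ
  have hs : (σ k)⁻¹ • (s k - s (k + 1)) + w (k + 1) ∈ subdiff rankLoss (s (k + 1)) := by
    obtain ⟨u, hu, hsu⟩ := h.step_s k
    have hL := isSublinear_rankLoss (n := n)
    have h1 := hL.mem_subdiff_smul (hu.sub_mem_subdiff hL.convexOn) hσ.le
    rw [← hsu] at h1
    convert h1 using 1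
    rw [smul_sub, hsu, smul_smul, inv_mul_cancel₀ hσ.ne', one_smul]
    abel
  have hβ : (σ k)⁻¹ • (β k - β (k + 1)) - mulVecL P.X.transpose (w (k + 1))
      ∈ subdiff (fun β => P.lam * P.reg β) (β (k + 1)) := by
    obtain ⟨u, hu, hsu⟩ := h.step_beta k
    have hR := P.isSublinear_reg
    have h1 := smul_mem_subdiff hlam.le
      (hR.mem_subdiff_smul (hu.sub_mem_subdiff hR.convexOn) (mul_pos hσ hlam).le)
    rw [← hsu] at h1
    convert h1 using 1
    rw [hsu, mulVecE_eq]
    simp only [smul_sub, smul_smul]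
    have e1 : (σ k)⁻¹ * (σ k * P.lam) = P.lam := by field_simp
    have e2 : P.lam * (σ k * P.lam)⁻¹ = (σ k)⁻¹ := by field_simp
    have e3 : P.lam * P.lam⁻¹ = 1 := by field_simp
    rw [e1, e2, e3, one_smul]
    abel
  obtain ⟨G, hG, hGle⟩ := h.step_w k
  have hGeq := gradient_subObj_eq P hσ hs hβ hG
  refine ⟨scale τ (w k, s k, β k) + σ k • scale τ⁻¹ (G, 0, 0), ?_, ?_⟩
  · rw [P.mem_scaledOp_scale hτ, P.mem_kktOp]
    have e1 : (unscale τ⁻¹ ((σ k)⁻¹ • (scale τ (w k, s k, β k) + σ k • scale τ⁻¹ (G, 0, 0)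
        - scale τ (w (k + 1), s (k + 1), β (k + 1)))) : Point n p)
        = (P.y + s (k + 1) - mulVecL P.X (β (k + 1)), (σ k)⁻¹ • (s k - s (k + 1)),
          (σ k)⁻¹ • (β k - β (k + 1))) := by
      refine Prod.ext ?_ (Prod.ext ?_ ?_)
      · simp only [unscale, Real.sqrt_inv, inv_inv, WithLp.smul_fst, WithLp.sub_fst,
          WithLp.add_fst, scale_fst]
        have e2 : P.y + s (k + 1) - mulVecL P.X (β (k + 1))
            = G - (τ / σ k) • (w (k + 1) - w k) := by rw [hGeq]; abel
        rw [e2]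
        simp only [smul_sub, smul_add, smul_smul]
        have e3 : Real.sqrt τ * ((σ k)⁻¹ * Real.sqrt τ) = τ / σ k := by
          rw [mul_left_comm, Real.mul_self_sqrt hτ.le, inv_mul_eq_div]
        have e4 : Real.sqrt τ * ((σ k)⁻¹ * (σ k * (Real.sqrt τ)⁻¹)) = 1 := by field_simp
        rw [e3, e4, one_smul]
        abel
      · simp [unscale]
      · simp [unscale]
    rw [e1]
    exact ⟨rfl, hs, hβ⟩
  · rw [add_sub_cancel_left, norm_smul, Real.norm_of_nonneg hσ.le, norm_scale (inv_nonneg.2 hτ.le)]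
    have e1 : wnorm τ⁻¹ ((G, 0, 0) : Point n p) = (Real.sqrt τ)⁻¹ * ‖G‖ := by
      simp [wnorm, Real.sqrt_mul, hτ.le]
    have e2 : wnorm 1 ((Real.sqrt τ • w (k + 1), s (k + 1), β (k + 1))
        - (Real.sqrt τ • w k, s k, β k) : Point n p)
        = ‖scale τ (w (k + 1), s (k + 1), β (k + 1)) - scale τ (w k, s k, β k)‖ := by
      rw [← norm_scale zero_le_one, scale_sub]
      simp [scale]
    rw [e2] at hGle
    rw [e1]
    set M := min 1 ‖scale τ (w (k + 1), s (k + 1), β (k + 1)) - scale τ (w k, s k, β k)‖ with hM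
    have hM0 : 0 ≤ M := le_min zero_le_one (norm_nonneg _)
    have hδ := (h.delta_pos k).le
    calc σ k * ((Real.sqrt τ)⁻¹ * ‖G‖)
        ≤ σ k * ((Real.sqrt τ)⁻¹ * (δ k * min 1 (Real.sqrt τ) / σ k * M)) := by gcongr
      _ ≤ σ k * ((Real.sqrt τ)⁻¹ * (δ k * Real.sqrt τ / σ k * M)) := by
          gcongr; exact min_le_right _ _
      _ = δ k * M := by field_simp

end Run

/-! ### Convergence and rate -/

section Rate

variable {n p g : ℕ} {P : Problem n p g} {τ : ℝ} {σ δ : ℕ → ℝ} {w s : ℕ → Vec n} {β : ℕ → Vec p}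

/-- The exact proximal points of the iterates, in weighted coordinates. -/
theorem IsPALM.exists_proximalPoints (h : IsPALM P τ σ δ w s β) :
    ∃ q : ℕ → Scaled n p, ∀ k,
      (σ k)⁻¹ • (scale τ (w k, s k, β k) - q k) ∈ P.scaledOp τ (q k) ∧
      ‖scale τ (w (k + 1), s (k + 1), β (k + 1)) - q k‖ ≤ δ k ∧
      ‖scale τ (w (k + 1), s (k + 1), β (k + 1)) - q k‖
        ≤ δ k * ‖scale τ (w (k + 1), s (k + 1), β (k + 1)) - scale τ (w k, s k, β k)‖ := by
  have hA := P.isMaxMonotone_scaledOp h.tau_pos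
  choose q hq using fun k => hA.range (σ k) (h.sigma_pos' k) (scale τ (w k, s k, β k))
  refine ⟨q, fun k => ⟨hq k, ?_⟩⟩
  obtain ⟨a, ha, hle⟩ := h.exists_step k
  have h1 := (hA.norm_sub_le (h.sigma_pos' k) ha (hq k)).trans hle
  have hδ := (h.delta_pos k).le
  exact ⟨h1.trans (mul_le_of_le_one_right hδ (min_le_left _ _)),
    h1.trans (mul_le_mul_of_nonneg_left (min_le_right _ _) hδ)⟩

theorem IsPALM.tendsto_kktSet (h : IsPALM P τ σ δ w s β) : ∃ z ∈ P.kktSet,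
    Tendsto w atTop (𝓝 z.1) ∧ Tendsto s atTop (𝓝 z.2.1) ∧ Tendsto β atTop (𝓝 z.2.2) := by
  have hτ := h.tau_pos
  obtain ⟨q, hq⟩ := h.exists_proximalPoints
  obtain ⟨x, hx, hlim⟩ := (P.isMaxMonotone_scaledOp hτ).tendsto_proximalPoint
    (P.zeros_scaledOp_nonempty hτ) (x := fun k => scale τ (w k, s k, β k)) h.sigma_pos h.sigma_le
    (fun k => (h.delta_pos k).le) h.delta_summable (fun k => (hq k).1) (fun k => (hq k).2.1)
  have hx' : x ∈ scale τ '' P.kktSet := by rw [← P.zeros_scaledOp hτ]; exact hx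
  obtain ⟨z, hz, rfl⟩ := hx'
  have h1 := ((continuous_unscale τ).tendsto _).comp hlim
  simp only [Function.comp_def, unscale_scale hτ] at h1
  exact ⟨z, hz, h1.fst_nhds, h1.snd_nhds.fst_nhds, h1.snd_nhds.snd_nhds⟩

theorem ErrorBound.dichotomy {κ r : ℝ} (hκ : 0 ≤ κ) (hEB : ErrorBound P κ r) {z v : Point n p}
    (hv : v ∈ P.kktOp z) : eucDist z P.kktSet ≤ κ * wnorm 1 v ∨ r ≤ κ * wnorm 1 v := by
  have hle : ∀ {z v : Point n p}, eucDist z P.kktSet ≤ r → v ∈ P.kktOp z →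
      eucDist z P.kktSet ≤ κ * wnorm 1 v := fun {z v} h hv => by
    refine (hEB z h).trans (mul_le_mul_of_nonneg_left ?_ hκ)
    have := wdist_le_wnorm 1 0 hv
    rwa [← norm_scale zero_le_one, scale_sub, scale_zero, zero_sub, norm_neg,
      norm_scale zero_le_one] at this
  rcases le_or_gt (eucDist z P.kktSet) r with h | h
  · exact Or.inl (hle h hv)
  right
  have h1 := (P.isMaxMonotone_scaledOp one_pos).radius_le_of_errorBound
    (P.zeros_scaledOp_nonempty one_pos) hκ (r := r) (x := scale 1 z) (u := scale 1 v)
    (fun x u hx hu => ?_) ?_ ?_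
  · rwa [norm_scale zero_le_one] at h1
  · obtain ⟨x, rfl⟩ : ∃ z, scale 1 z = x := ⟨_, scale_unscale one_pos x⟩
    obtain ⟨u, rfl⟩ : ∃ z, scale 1 z = u := ⟨_, scale_unscale one_pos u⟩
    rw [P.infDist_scale one_pos] at hx ⊢
    rw [P.mem_scaledOp_scale one_pos, inv_one, unscale_scale one_pos] at hu
    rw [norm_scale zero_le_one]
    exact hle hx hu
  · rwa [P.mem_scaledOp_scale one_pos, inv_one, unscale_scale one_pos]
  · rwa [P.infDist_scale one_pos]

theorem IsPALM.wdist_le (h : IsPALM P τ σ δ w s β) {r κ : ℝ}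
    (hκ : 0 < κ) (hEB : ErrorBound P κ r)
    (h0 : eucDist (w 0, s 0, β 0) P.kktSet ≤ r - ∑' k, δ k) (k : ℕ) :
    wdist τ (w (k + 1), s (k + 1), β (k + 1)) P.kktSet ≤
      rate κ τ (σ k) (δ k) * wdist τ (w k, s k, β k) P.kktSet := by
  have hτ := h.tau_pos
  have hA := P.isMaxMonotone_scaledOp hτ
  have hZ := P.zeros_scaledOp_nonempty hτ
  have hδ := fun k => (h.delta_pos k).le
  obtain ⟨q, hq⟩ := h.exists_proximalPoints
  have hγ1 : 1 ≤ Real.sqrt (max 1 τ) := Real.one_le_sqrt.2 (le_max_left _ _)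
  set γ := Real.sqrt (max 1 τ) with hγ
  have hγγ : γ * γ = max 1 τ := Real.mul_self_sqrt (by positivity)
  set Z := {x | (0 : Scaled n p) ∈ P.scaledOp τ x} with hZdef
  have hqx : ∀ k, Metric.infDist (q k) Z ≤ wdist τ (w k, s k, β k) P.kktSet := fun k => by
    rw [← P.infDist_scale hτ]
    exact le_of_sq_le_sq (by
      have := hA.infDist_sq_add_le (h.sigma_pos' k) (hq k).1 hZ
      linarith [sq_nonneg ‖scale τ (w k, s k, β k) - q k‖]) Metric.infDist_nonneg
  have hbound : ∀ k, wdist τ (w k, s k, β k) P.kktSet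
      ≤ γ * (r - ∑' k, δ k) + ∑ j ∈ Finset.range k, δ j := by
    intro k
    induction k with
    | zero =>
      rw [Finset.sum_range_zero, add_zero]
      exact (wdist_le_sqrt_max_mul _ P.kktSet_nonempty).trans
        (mul_le_mul_of_nonneg_left h0 (by positivity))
    | succ k ih =>
      rw [Finset.sum_range_succ, ← P.infDist_scale hτ]
      have h1 := Metric.infDist_le_infDist_add_dist (s := Z)
        (x := scale τ (w (k + 1), s (k + 1), β (k + 1))) (y := q k)
      rw [dist_eq_norm] at h1
      linarith [(hq k).2.1, hqx k]
  have hbound' : wdist τ (w k, s k, β k) P.kktSet ≤ γ * r := by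
    have h1 := h.delta_summable.sum_le_tsum (Finset.range k) fun j _ => hδ j
    have h2 : 1 * ∑' k, δ k ≤ γ * ∑' k, δ k :=
      mul_le_mul_of_nonneg_right hγ1 (tsum_nonneg hδ)
    linarith [hbound k]
  have hres : Metric.infDist (q k) Z
      ≤ κ * max 1 τ * ‖(σ k)⁻¹ • (scale τ (w k, s k, β k) - q k)‖ := by
    obtain ⟨y, hy⟩ : ∃ y, scale τ y = q k := ⟨_, scale_unscale hτ _⟩
    have hu := (hq k).1
    rw [← hy, P.mem_scaledOp_scale hτ, hy] at hu
    set u := (σ k)⁻¹ • (scale τ (w k, s k, β k) - q k) with hu'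
    have hun : ‖u‖ = wnorm τ⁻¹ (unscale τ⁻¹ u) := by
      rw [← norm_scale (inv_nonneg.2 hτ.le), scale_unscale (inv_pos.2 hτ)]
    have h1 := wnorm_one_le_sqrt_max_mul hτ (unscale τ⁻¹ u)
    rw [← hun] at h1
    have key : ∀ t, t ≤ κ * wnorm 1 (unscale τ⁻¹ u) → γ * t ≤ κ * max 1 τ * ‖u‖ := fun t ht => by
      calc γ * t ≤ γ * (κ * (γ * ‖u‖)) := by
            gcongr; exact ht.trans (mul_le_mul_of_nonneg_left h1 hκ.le)
        _ = κ * max 1 τ * ‖u‖ := by rw [← hγγ]; ring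
    rcases hEB.dichotomy hκ.le hu with h2 | h2
    · refine le_trans ?_ (key _ h2)
      rw [← hy, P.infDist_scale hτ]
      exact wdist_le_sqrt_max_mul _ P.kktSet_nonempty
    · exact ((hqx k).trans hbound').trans (key _ h2)
  have hK : 0 < κ * max 1 τ := by positivity
  have h1 := hA.infDist_inexact_le hZ (h.sigma_pos' k) hK (hδ k) (h.delta_lt_one k) (hq k).1 hres
    (hq k).2.2
  rw [P.infDist_scale hτ, P.infDist_scale hτ, mul_pow] at h1
  exact h1

theorem div_sqrt_lt_one {K t : ℝ} (ht : 0 < t) : K / Real.sqrt (t ^ 2 + K ^ 2) < 1 := by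
  have hpos : 0 < t ^ 2 + K ^ 2 := by positivity
  rw [div_lt_one (Real.sqrt_pos.2 hpos)]
  exact Real.lt_sqrt_of_sq_lt (by linarith [pow_pos ht 2])

theorem tendsto_rate {κ : ℝ} (hδ : Tendsto δ atTop (𝓝 0)) {l : ℝ}
    (hl : Tendsto (fun k => κ * max 1 τ / Real.sqrt (σ k ^ 2 + κ ^ 2 * (max 1 τ) ^ 2)) atTop (𝓝 l)) :
    Tendsto (fun k => rate κ τ (σ k) (δ k)) atTop (𝓝 l) := by
  have h1 : Tendsto (fun k => (1 - δ k)⁻¹ * (δ k + (1 + δ k) *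
      (κ * max 1 τ / Real.sqrt (σ k ^ 2 + κ ^ 2 * (max 1 τ) ^ 2)))) atTop
      (𝓝 ((1 - 0)⁻¹ * (0 + (1 + 0) * l))) :=
    ((hδ.const_sub 1).inv₀ (by norm_num)).mul (hδ.add ((hδ.const_add 1).mul hl))
  rw [sub_zero, inv_one, one_mul, zero_add, add_zero, one_mul] at h1
  refine h1.congr fun k => ?_
  rw [rate, ← mul_div_assoc]

theorem tendsto_rate_of_tendsto {κ σ' : ℝ} (hδ : Tendsto δ atTop (𝓝 0)) (hσ' : 0 < σ')
    (hσ : Tendsto σ atTop (𝓝 σ')) :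
    Tendsto (fun k => rate κ τ (σ k) (δ k)) atTop
      (𝓝 (κ * max 1 τ / Real.sqrt (σ' ^ 2 + κ ^ 2 * (max 1 τ) ^ 2))) :=
  tendsto_rate hδ (tendsto_const_nhds.div ((hσ.pow 2).add_const _).sqrt (by positivity))

theorem tendsto_rate_zero {κ : ℝ} (hδ : Tendsto δ atTop (𝓝 0)) (hσ : Tendsto σ atTop atTop) :
    Tendsto (fun k => rate κ τ (σ k) (δ k)) atTop (𝓝 0) := by
  refine tendsto_rate hδ (Tendsto.const_div_atTop (tendsto_atTop_mono (fun k => ?_) hσ) _)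
  exact Real.le_sqrt_of_sq_le (by nlinarith [sq_nonneg (κ * max 1 τ)])

theorem IsPALM.exists_linear_rate (h : IsPALM P τ σ δ w s β) {κ : ℝ} (hκ : 0 < κ)
    (hle : ∀ k, wdist τ (w (k + 1), s (k + 1), β (k + 1)) P.kktSet ≤
      rate κ τ (σ k) (δ k) * wdist τ (w k, s k, β k) P.kktSet) :
    ∃ ρ : ℝ, 0 ≤ ρ ∧ ρ < 1 ∧ ∀ᶠ k in atTop,
      wdist τ (w (k + 1), s (k + 1), β (k + 1)) P.kktSet ≤
        ρ * wdist τ (w k, s k, β k) P.kktSet := by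
  have hδ := h.delta_summable.tendsto_atTop_zero
  have h1 : Tendsto (fun k => rate κ τ (σ 0) (δ k)) atTop _ :=
    tendsto_rate_of_tendsto (κ := κ) (τ := τ) (σ := fun _ => σ 0) hδ h.sigma_pos
      tendsto_const_nhds
  have hlt : κ * max 1 τ / Real.sqrt (σ 0 ^ 2 + κ ^ 2 * (max 1 τ) ^ 2) < 1 := by
    rw [← mul_pow]; exact div_sqrt_lt_one h.sigma_pos
  obtain ⟨ρ, hρ, hρ1⟩ := exists_between hlt
  refine ⟨ρ, le_trans (by positivity) hρ.le, hρ1, ?_⟩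
  filter_upwards [h1.eventually (gt_mem_nhds hρ)] with k hk
  refine (hle k).trans (mul_le_mul_of_nonneg_right (le_trans ?_ hk.le) (wdist_nonneg _ _ _))
  have hδ0 := h.delta_pos k
  have hδ1 : 0 < 1 - δ k := by linarith [h.delta_lt_one k]
  have hσ0 := h.sigma_pos
  have hσk := h.sigma_le k
  unfold rate
  gcongr

end Rate

/-! ### Hoffman's bound, by Fourier–Motzkin elimination -/

section Hoffman

/-- Near-solutions of a system of finitely many linear inequalities are close to solutions, with
a linear estimate. For infeasible systems there are no near-solutions. -/
def HoffmanProperty (E : Type*) [NormedAddCommGroup E] [NormedSpace ℝ E] : Prop :=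
  ∀ (ι : Type) [Fintype ι] (ℓ : ι → E →L[ℝ] ℝ) (b : ι → ℝ), ∃ κ : ℝ, 0 ≤ κ ∧
    ∀ x t, 0 ≤ t → κ * t ≤ 1 → (∀ i, ℓ i x ≤ b i + t) → ∃ y, (∀ i, ℓ i y ≤ b i) ∧ ‖x - y‖ ≤ κ * t

variable {E F : Type*} [NormedAddCommGroup E] [NormedSpace ℝ E] [NormedAddCommGroup F]
  [NormedSpace ℝ F]

theorem hoffmanProperty_of_subsingleton [Subsingleton E] : HoffmanProperty E := by
  intro ι _ ℓ b
  by_cases h : ∀ i, 0 ≤ b i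
  · refine ⟨0, le_rfl, fun x t _ _ _ => ⟨x, fun i => ?_, by simp⟩⟩
    rw [Subsingleton.elim x 0, map_zero]
    exact h i
  · push Not at h
    obtain ⟨i, hi⟩ := h
    refine ⟨2 / -b i, div_nonneg zero_le_two (by linarith), fun x t ht ht1 hx => ?_⟩
    have h1 := hx i
    rw [Subsingleton.elim x 0, map_zero] at h1
    rw [div_mul_eq_mul_div, div_le_one (by linarith)] at ht1
    linarith

theorem HoffmanProperty.congr (h : HoffmanProperty E) (e : E ≃L[ℝ] F) : HoffmanProperty F := by
  intro ι _ ℓ b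
  obtain ⟨κ, hκ, H⟩ := h ι (fun i => (ℓ i).comp (e : E →L[ℝ] F)) b
  set N := ‖(e : E →L[ℝ] F)‖
  have hN : 0 ≤ N := norm_nonneg _
  refine ⟨(1 + N) * κ, by positivity, fun x t ht ht1 hx => ?_⟩
  have hκt : 0 ≤ κ * t := by positivity
  obtain ⟨y, hy, hxy⟩ := H (e.symm x) t ht (by nlinarith [mul_nonneg hN hκt])
    (fun i => by simpa using hx i)
  refine ⟨e y, fun i => hy i, ?_⟩
  have h1 := (e : E →L[ℝ] F).le_opNorm (e.symm x - y)
  rw [map_sub] at h1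
  simp only [ContinuousLinearEquiv.coe_coe, ContinuousLinearEquiv.apply_symm_apply] at h1
  nlinarith [mul_le_mul_of_nonneg_left hxy hN]

/-- A point of a nonempty intersection of rays that is close to a near-solution. -/
theorem exists_between_of_le {ι : Type*} [Fintype ι] (pos neg : ι → Prop) (u l : ι → ℝ) {s D : ℝ}
    (hD : 0 ≤ D) (hu : ∀ i, pos i → s - D ≤ u i) (hl : ∀ j, neg j → l j ≤ s + D)
    (hlu : ∀ i j, pos i → neg j → l j ≤ u i) :
    ∃ s', |s - s'| ≤ D ∧ (∀ i, pos i → s' ≤ u i) ∧ ∀ j, neg j → l j ≤ s' := by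
  classical
  let S := insert (s - D) ((Finset.univ.filter neg).image l)
  have hne : S.Nonempty := Finset.insert_nonempty _ _
  have hmem := S.max'_mem hne
  have h0 : s - D ≤ S.max' hne := S.le_max' _ (Finset.mem_insert_self _ _)
  have h1 : ∀ j, neg j → l j ≤ S.max' hne := fun j hj => S.le_max' _
    (Finset.mem_insert_of_mem (Finset.mem_image_of_mem _ (by simpa using hj)))
  rcases Finset.mem_insert.1 hmem with h | h
  · refine ⟨S.max' hne, abs_le.2 ⟨by rw [h]; linarith, by linarith⟩, fun i hi => ?_, h1⟩
    exact h.le.trans (hu i hi)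
  · obtain ⟨j, hj, h⟩ := Finset.mem_image.1 h
    have hj' : neg j := by simpa using hj
    have h2 : S.max' hne ≤ s + D := h.ge.trans (hl j hj')
    exact ⟨S.max' hne, abs_le.2 ⟨by linarith, by linarith⟩,
      fun i hi => h.ge.trans (hlu i j hi hj'), h1⟩

theorem HoffmanProperty.prod_real (h : HoffmanProperty E) : HoffmanProperty (E × ℝ) := by
  intro ι _ ℓ b
  classical
  set G : ι → E →L[ℝ] ℝ := fun i => (ℓ i).comp (ContinuousLinearMap.inl ℝ E ℝ) with hG
  set c : ι → ℝ := fun i => ℓ i (0, 1) with hc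
  have hℓ : ∀ i x s, ℓ i (x, s) = G i x + c i * s := fun i x s => by
    have : ((x, s) : E × ℝ) = (x, 0) + s • (0, 1) := by simp
    rw [this, map_add, map_smul, smul_eq_mul, mul_comm s]
    rfl
  obtain ⟨κ, hκ, H⟩ := h (ι × ι)
    (fun q => if c q.1 = 0 then G q.1 else
      if 0 < c q.1 ∧ c q.2 < 0 then (-c q.2) • G q.1 + c q.1 • G q.2 else 0)
    (fun q => if c q.1 = 0 then b q.1 else
      if 0 < c q.1 ∧ c q.2 < 0 then (-c q.2) * b q.1 + c q.1 * b q.2 else 0)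
  set M := 1 + 2 * ∑ i, |c i| with hM
  set N := ∑ i, ‖G i‖ with hN
  set W := ∑ i, |c i|⁻¹ with hW
  have hM1 : 1 ≤ M := by
    have : 0 ≤ ∑ i, |c i| := Finset.sum_nonneg fun _ _ => abs_nonneg _
    linarith
  have hN0 : 0 ≤ N := Finset.sum_nonneg fun _ _ => norm_nonneg _
  have hW0 : 0 ≤ W := Finset.sum_nonneg fun _ _ => inv_nonneg.2 (abs_nonneg _)
  have hcle : ∀ i, |c i| ≤ ∑ i, |c i| := fun i =>
    Finset.single_le_sum (f := fun i => |c i|) (fun _ _ => abs_nonneg _) (Finset.mem_univ i)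
  have hGle : ∀ i v, |G i v| ≤ N * ‖v‖ := fun i v => ((G i).le_opNorm v).trans
    (mul_le_mul_of_nonneg_right (Finset.single_le_sum (f := fun i => ‖G i‖)
      (fun _ _ => norm_nonneg _) (Finset.mem_univ i)) (norm_nonneg _))
  have hWle : ∀ i, |c i|⁻¹ ≤ W := fun i => Finset.single_le_sum (f := fun i => |c i|⁻¹)
    (fun _ _ => inv_nonneg.2 (abs_nonneg _)) (Finset.mem_univ i)
  set κ' := κ * M with hκ'
  have hκ'0 : 0 ≤ κ' := by positivity
  refine ⟨κ' + W * (1 + N * κ'), by positivity, ?_⟩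
  rintro ⟨x, s⟩ t ht ht1 hx
  have hx' : ∀ i, G i x + c i * s ≤ b i + t := fun i => by rw [← hℓ]; exact hx i
  have hWt : 0 ≤ W * (1 + N * κ') * t := by positivity
  obtain ⟨y, hy, hxy⟩ := H x (M * t) (by positivity) (by rw [← mul_assoc]; linarith) (by
    rintro ⟨i, j⟩
    simp only
    have hMt : t ≤ M * t := le_mul_of_one_le_left ht hM1
    split_ifs with h1 h2
    · have := hx' i
      rw [h1] at this
      linarith
    · have e1 := mul_le_mul_of_nonneg_left (hx' i) (neg_nonneg.2 h2.2.le)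
      have e2 := mul_le_mul_of_nonneg_left (hx' j) h2.1.le
      have e3 : (-c j + c i) * t ≤ M * t := by
        refine mul_le_mul_of_nonneg_right ?_ ht
        have := hcle i
        have := hcle j
        linarith [neg_le_abs (c j), le_abs_self (c i)]
      simp only [add_apply, smul_apply, smul_eq_mul]
      linarith
    · simp only [zero_apply]
      linarith)
  rw [← mul_assoc] at hxy
  set D := W * (1 + N * κ') * t with hD
  have hdist : ∀ i, |G i y - G i x| ≤ N * (κ' * t) := fun i => by
    rw [← map_sub]
    refine (hGle i _).trans (mul_le_mul_of_nonneg_left ?_ hN0)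
    rwa [norm_sub_rev]
  have hviol : ∀ i, G i y + c i * s ≤ b i + (1 + N * κ') * t := fun i => by
    have := hx' i
    have := (abs_le.1 (hdist i)).2
    linarith
  have hDi : ∀ i, c i ≠ 0 → (1 + N * κ') * t ≤ |c i| * D := fun i hi => by
    have h1 : 0 < |c i| := abs_pos.2 hi
    have h2 : |c i|⁻¹ * ((1 + N * κ') * t) ≤ D := by
      rw [hD, mul_assoc]
      exact mul_le_mul_of_nonneg_right (hWle i) (by positivity)
    rwa [inv_mul_le_iff₀ h1] at h2
  obtain ⟨s', hs', hup, hlow⟩ := exists_between_of_le (fun i => 0 < c i) (fun j => c j < 0)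
    (fun i => (b i - G i y) / c i) (fun j => (b j - G j y) / c j) (s := s) (D := D) hWt
    (fun i hi => by
      rw [le_div_iff₀ hi]
      have h1 := hDi i hi.ne'
      rw [abs_of_pos hi] at h1
      linarith [hviol i])
    (fun j hj => by
      rw [div_le_iff_of_neg hj]
      have h1 := hDi j hj.ne
      rw [abs_of_neg hj] at h1
      linarith [hviol j])
    (fun i j hi hj => by
      rw [div_le_iff_of_neg hj, div_mul_eq_mul_div, div_le_iff₀ hi]
      have h1 := hy (i, j)
      simp only [hi.ne', if_false, hi, hj, and_self, if_true, add_apply, smul_apply,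
        smul_eq_mul] at h1
      linarith)
  refine ⟨(y, s'), fun i => ?_, ?_⟩
  · rw [hℓ]
    rcases lt_trichotomy (c i) 0 with hi | hi | hi
    · have := hlow i hi
      rw [div_le_iff_of_neg hi] at this
      linarith
    · have h1 := hy (i, i)
      simp only [hi, if_true] at h1
      rw [hi]
      linarith
    · have := hup i hi
      rw [le_div_iff₀ hi] at this
      linarith
  · rw [Prod.mk_sub_mk, Prod.norm_mk, Real.norm_eq_abs, add_mul]
    exact max_le (hxy.trans (le_add_of_nonneg_right hWt))
      (hs'.trans (le_add_of_nonneg_left (by positivity)))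

theorem hoffmanProperty [FiniteDimensional ℝ E] : HoffmanProperty E := by
  have key : ∀ k : ℕ, HoffmanProperty (Fin k → ℝ) := by
    intro k
    induction k with
    | zero => exact hoffmanProperty_of_subsingleton
    | succ k ih =>
      exact ih.prod_real.congr
        (LinearEquiv.ofFinrankEq ((Fin k → ℝ) × ℝ) (Fin (k + 1) → ℝ)
          (by simp)).toContinuousLinearEquiv
  exact (key (Module.finrank ℝ E)).congr
    (LinearEquiv.ofFinrankEq (Fin (Module.finrank ℝ E) → ℝ) E (by simp)).toContinuousLinearEquiv

/-- Families of conditions `Q t` on points that imply a system of linear inequalities up to a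
multiple of `t`, such that the system itself implies `Q 0`. -/
def IsLinearSystem (Q : ℝ → E → Prop) : Prop :=
  ∃ (ι : Type) (_ : Fintype ι) (ℓ : ι → E →L[ℝ] ℝ) (b : ι → ℝ) (C : ℝ), 0 ≤ C ∧
    (∀ t x, 0 ≤ t → Q t x → ∀ i, ℓ i x ≤ b i + C * t) ∧ ∀ x, (∀ i, ℓ i x ≤ b i) → Q 0 x

theorem IsLinearSystem.forall {K : Type} [Fintype K] {Q : K → ℝ → E → Prop}
    (h : ∀ k, IsLinearSystem (Q k)) : IsLinearSystem fun t x => ∀ k, Q k t x := by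
  choose ι hι ℓ b C hC h1 h2 using h
  refine ⟨Σ k, ι k, inferInstance, fun q => ℓ q.1 q.2, fun q => b q.1 q.2, ∑ k, C k,
    Finset.sum_nonneg fun k _ => hC k, fun t x ht hQ q => ?_, fun x hx k => ?_⟩
  · refine (h1 q.1 t x ht (hQ q.1) q.2).trans (add_le_add le_rfl ?_)
    exact mul_le_mul_of_nonneg_right
      (Finset.single_le_sum (fun k _ => hC k) (Finset.mem_univ q.1)) ht
  · exact h2 k x fun i => hx ⟨k, i⟩

theorem IsLinearSystem.and {Q R : ℝ → E → Prop} (hQ : IsLinearSystem Q) (hR : IsLinearSystem R) :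
    IsLinearSystem fun t x => Q t x ∧ R t x := by
  have h := IsLinearSystem.forall (K := Bool) (Q := fun k => bif k then Q else R)
    (fun k => by cases k <;> assumption)
  simpa [and_comm] using h

theorem isLinearSystem_imp {A : Prop} {Q : ℝ → E → Prop} (h : A → IsLinearSystem Q) :
    IsLinearSystem fun t x => A → Q t x := by
  by_cases hA : A
  · simpa [hA] using h hA
  · exact ⟨Empty, inferInstance, Empty.rec, Empty.rec, 0, le_rfl, fun _ _ _ _ i => i.elim,
      fun _ _ h => absurd h hA⟩

theorem isLinearSystem_le (ℓ : E →L[ℝ] ℝ) (b C : ℝ) (hC : 0 ≤ C) :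
    IsLinearSystem fun t x => ℓ x ≤ b + C * t :=
  ⟨Unit, inferInstance, fun _ => ℓ, fun _ => b, C, hC, fun _ _ _ h _ => h,
    fun x h => by simpa using h ()⟩

theorem isLinearSystem_eq (ℓ : E →L[ℝ] ℝ) (b : ℝ) : IsLinearSystem fun _ x => ℓ x = b := by
  have h := (isLinearSystem_le ℓ b 0 le_rfl).and (isLinearSystem_le (-ℓ) (-b) 0 le_rfl)
  simp only [zero_mul, add_zero, neg_apply, neg_le_neg_iff] at h
  simpa only [← le_antisymm_iff] using h

theorem isLinearSystem_norm_le {m : ℕ} (e : E →L[ℝ] Vec m) (c : Vec m) :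
    IsLinearSystem fun t x => ‖e x - c‖ ≤ t := by
  have hp : ∀ (j : Fin m) (v : Vec m), (EuclideanSpace.proj j : Vec m →L[ℝ] ℝ) v = v j :=
    fun _ _ => rfl
  refine ⟨Fin m ⊕ Fin m, inferInstance,
    Sum.elim (fun j => (EuclideanSpace.proj j : Vec m →L[ℝ] ℝ).comp e)
      (fun j => -(EuclideanSpace.proj j : Vec m →L[ℝ] ℝ).comp e),
    Sum.elim (fun j => c j) (fun j => -c j), 1, zero_le_one, fun t x ht hx i => ?_, fun x hx => ?_⟩
  · have h1 : ∀ j, |e x j - c j| ≤ t := fun j => by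
      have := PiLp.norm_apply_le (e x - c) j
      rw [PiLp.sub_apply, Real.norm_eq_abs] at this
      exact this.trans hx
    rcases i with j | j
    · have := (abs_le.1 (h1 j)).2
      simp only [Sum.elim_inl, ContinuousLinearMap.comp_apply, hp]
      linarith
    · have := (abs_le.1 (h1 j)).1
      simp only [Sum.elim_inr, neg_apply, ContinuousLinearMap.comp_apply,
        hp]
      linarith
  · have h1 : e x = c := by
      ext j
      have e1 := hx (Sum.inl j)
      have e2 := hx (Sum.inr j)
      simp only [Sum.elim_inl, Sum.elim_inr, neg_apply, ContinuousLinearMap.comp_apply,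
        hp] at e1 e2
      linarith
    simp [h1]

theorem IsLinearSystem.exists_bound [FiniteDimensional ℝ E] {Q : ℝ → E → Prop}
    (h : IsLinearSystem Q) : ∃ κ : ℝ, 0 ≤ κ ∧ ∀ x t, 0 ≤ t → κ * t ≤ 1 → Q t x →
      ∃ y, Q 0 y ∧ ‖x - y‖ ≤ κ * t := by
  obtain ⟨ι, _, ℓ, b, C, hC, h1, h2⟩ := h
  obtain ⟨κ, hκ, H⟩ := hoffmanProperty ι ℓ b
  refine ⟨κ * C, by positivity, fun x t ht ht1 hQ => ?_⟩
  rw [mul_assoc] at ht1 ⊢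
  obtain ⟨y, hy, hxy⟩ := H x (C * t) (by positivity) ht1 (h1 t x ht hQ)
  exact ⟨y, h2 y hy, hxy⟩

end Hoffman

/-! ### Maxima of finitely many linear functions -/

section MaxLinear

variable {m : ℕ}

/-- `f` is the pointwise maximum of the linear functions with gradients in `S`. -/
def IsMaxLinear (S : Finset (Vec m)) (f : Vec m → ℝ) : Prop :=
  (∀ a ∈ S, ∀ x, inner ℝ a x ≤ f x) ∧ ∀ x, ∃ a ∈ S, f x = inner ℝ a x

theorem isMaxLinear_zero : IsMaxLinear {0} (fun _ : Vec m => 0) :=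
  ⟨fun a ha x => by simp [Finset.mem_singleton.1 ha], fun x => ⟨0, by simp, by simp⟩⟩

theorem exists_isMaxLinear_abs (d : Vec m) :
    ∃ S, IsMaxLinear S fun x => |(inner ℝ d x : ℝ)| := by
  classical
  refine ⟨{d, -d}, fun a ha x => ?_, fun x => ?_⟩
  · rcases Finset.mem_insert.1 ha with rfl | h
    · exact le_abs_self _
    · rw [Finset.mem_singleton.1 h, inner_neg_left]; exact neg_le_abs _
  · rcases abs_choice (inner ℝ d x : ℝ) with h | h
    · exact ⟨d, by simp, h⟩
    · exact ⟨-d, by simp, by rw [inner_neg_left]; exact h⟩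

theorem IsMaxLinear.const_mul {S : Finset (Vec m)} {f : Vec m → ℝ} (h : IsMaxLinear S f) {c : ℝ}
    (hc : 0 ≤ c) : ∃ S', IsMaxLinear S' fun x => c * f x := by
  classical
  refine ⟨S.image (c • ·), fun a ha x => ?_, fun x => ?_⟩
  · obtain ⟨b, hb, rfl⟩ := Finset.mem_image.1 ha
    rw [inner_smul_left]
    exact mul_le_mul_of_nonneg_left (h.1 b hb x) hc
  · obtain ⟨a, ha, he⟩ := h.2 x
    exact ⟨c • a, Finset.mem_image_of_mem _ ha, by simp [inner_smul_left, he]⟩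

theorem IsMaxLinear.add {S T : Finset (Vec m)} {f f' : Vec m → ℝ} (h : IsMaxLinear S f)
    (h' : IsMaxLinear T f') : ∃ S', IsMaxLinear S' fun x => f x + f' x := by
  classical
  refine ⟨Finset.image₂ (· + ·) S T, fun a ha x => ?_, fun x => ?_⟩
  · obtain ⟨b, hb, b', hb', rfl⟩ := Finset.mem_image₂.1 ha
    rw [inner_add_left]
    exact add_le_add (h.1 b hb x) (h'.1 b' hb' x)
  · obtain ⟨a, ha, he⟩ := h.2 x
    obtain ⟨a', ha', he'⟩ := h'.2 x
    exact ⟨a + a', Finset.mem_image₂_of_mem ha ha', by simp [inner_add_left, he, he']⟩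

theorem exists_isMaxLinear_sum {ι : Type*} (I : Finset ι) {f : ι → Vec m → ℝ}
    (h : ∀ i ∈ I, ∃ S, IsMaxLinear S (f i)) : ∃ S, IsMaxLinear S fun x => ∑ i ∈ I, f i x := by
  classical
  induction I using Finset.induction_on with
  | empty => exact ⟨{0}, by simpa using isMaxLinear_zero⟩
  | insert i I hi ih =>
    obtain ⟨S, hS⟩ := h i (Finset.mem_insert_self i I)
    obtain ⟨T, hT⟩ := ih fun j hj => h j (Finset.mem_insert_of_mem hj)
    simp_rw [Finset.sum_insert hi]
    exact hS.add hT

theorem exists_isMaxLinear_rankLoss (n : ℕ) : ∃ S, IsMaxLinear S (rankLoss (n := n)) := by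
  have h0 : 0 ≤ 1 / ((n : ℝ) * ((n : ℝ) - 1)) := by
    rcases n with _ | n
    · simp
    · push_cast; rw [add_sub_cancel_right]; positivity
  obtain ⟨S, hS⟩ := exists_isMaxLinear_sum (m := n) (f := fun i s => ∑ j ∈ Finset.univ.filter
    (fun j => j ≠ i), |s i - s j|) Finset.univ fun i _ => exists_isMaxLinear_sum _ fun j _ => by
      have := exists_isMaxLinear_abs (EuclideanSpace.single i (1 : ℝ) - EuclideanSpace.single j 1)
      simpa [inner_sub_left, EuclideanSpace.inner_single_left] using this
  exact hS.const_mul h0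

theorem Problem.exists_isMaxLinear_reg {n p g : ℕ} (P : Problem n p g)
    (hP : Function.Injective P.group) :
    ∃ S, IsMaxLinear S fun β => P.lam * P.reg β := by
  obtain ⟨S, hS⟩ := exists_isMaxLinear_sum (m := p) (f := fun l β => P.weight l *
    Real.sqrt (∑ j ∈ Finset.univ.filter (fun j => P.group j = l), β j ^ 2)) Finset.univ
    fun l _ => by
      by_cases h : ∃ i, P.group i = l
      · obtain ⟨i, rfl⟩ := h
        obtain ⟨T, hT⟩ := exists_isMaxLinear_abs (EuclideanSpace.single i (1 : ℝ))
        obtain ⟨T', hT'⟩ := hT.const_mul (P.weight_pos (P.group i)).le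
        refine ⟨T', ?_⟩
        convert hT' using 2 with β
        have : Finset.univ.filter (fun j => P.group j = P.group i) = {i} := by
          ext j; simp [hP.eq_iff]
        rw [this, Finset.sum_singleton, Real.sqrt_sq_eq_abs, EuclideanSpace.inner_single_left]
        simp
      · have : Finset.univ.filter (fun j => P.group j = l) = ∅ := by
          ext j
          simpa using fun hj => h ⟨j, hj⟩
        exact ⟨{0}, by simpa [this] using isMaxLinear_zero⟩
  exact hS.const_mul P.lam_pos.le

variable {S : Finset (Vec m)} {f : Vec m → ℝ}

theorem IsMaxLinear.subdiff_nonempty (h : IsMaxLinear S f) (x : Vec m) : (subdiff f x).Nonempty := by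
  obtain ⟨a, ha, he⟩ := h.2 x
  refine ⟨a, fun z => ?_⟩
  rw [inner_sub_right]
  linarith [h.1 a ha z]

/-- Subgradients are convex combinations of active gradients. -/
theorem IsMaxLinear.mem_convexHull (h : IsMaxLinear S f) {x v : Vec m} (hv : v ∈ subdiff f x) :
    v ∈ convexHull ℝ (S.filter (fun a => (inner ℝ a x : ℝ) = f x) : Set (Vec m)) := by
  by_contra hnot
  set A := S.filter (fun a => (inner ℝ a x : ℝ) = f x) with hA
  obtain ⟨φ, u, hφ, hu⟩ := geometric_hahn_banach_closed_point (convex_convexHull ℝ _)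
    (A.finite_toSet.isClosed_convexHull ℝ) hnot
  set d := (InnerProductSpace.toDual ℝ (Vec m)).symm φ with hd
  have hφd : ∀ z, φ z = inner ℝ d z := fun z =>
    (InnerProductSpace.toDual_symm_apply (𝕜 := ℝ) (E := Vec m)).symm
  have hev : ∀ᶠ t : ℝ in 𝓝[>] 0, ∀ a ∈ S, inner ℝ a (x + t • d) < f x + t * u := by
    refine (Filter.eventually_all_finset S).2 fun a ha => ?_
    by_cases hax : (inner ℝ a x : ℝ) = f x
    · filter_upwards [self_mem_nhdsWithin] with t ht
      have h1 := hφ a (subset_convexHull ℝ _ (by simp [hA, ha, hax]))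
      rw [hφd, real_inner_comm] at h1
      rw [inner_add_right, inner_smul_right, hax]
      have := mul_lt_mul_of_pos_left h1 ht
      linarith
    · have hlt : inner ℝ a x < f x := lt_of_le_of_ne (h.1 a ha x) hax
      have h1 : Tendsto (fun t : ℝ => f x + t * u - inner ℝ a (x + t • d)) (𝓝[>] 0)
          (𝓝 (f x + 0 * u - inner ℝ a (x + (0 : ℝ) • d))) :=
        ((by fun_prop : Continuous fun t : ℝ => f x + t * u - inner ℝ a (x + t • d)).tendsto
          0).mono_left nhdsWithin_le_nhds
      have h2 : 0 < f x + 0 * u - inner ℝ a (x + (0 : ℝ) • d) := by simpa using hlt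
      filter_upwards [h1.eventually (lt_mem_nhds h2)] with t ht
      linarith
  obtain ⟨t, ht, ht0⟩ := (hev.and self_mem_nhdsWithin).exists
  have ht0' : 0 < t := ht0
  obtain ⟨a, ha, he⟩ := h.2 (x + t • d)
  have h1 := ht a ha
  have h2 := hv (x + t • d)
  rw [add_sub_cancel_left, inner_smul_right, real_inner_comm, ← hφd] at h2
  have := mul_lt_mul_of_pos_left hu ht0'
  linarith

/-- The graph of the subdifferential over the points where the gradients in `A` are active,
with multipliers `μ` and a perturbation of size `t`. -/
def MultiplierSystem (S : Finset (Vec m)) (A : Finset S) (t : ℝ) (x v : Vec m) (μ : S → ℝ) :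
    Prop :=
  ‖v - ∑ k, μ k • (k : Vec m)‖ ≤ t ∧ (∀ k, 0 ≤ μ k) ∧ ∑ k, μ k = 1 ∧ (∀ k, k ∉ A → μ k = 0) ∧
    ∀ k ∈ A, ∀ j : S, (inner ℝ ((j : Vec m) - k) x : ℝ) ≤ 0

theorem IsMaxLinear.mem_subdiff_of_multiplierSystem (h : IsMaxLinear S f) {A : Finset S}
    {x v : Vec m} {μ : S → ℝ} (hμ : MultiplierSystem S A 0 x v μ) : v ∈ subdiff f x := by
  obtain ⟨h1, h2, h3, h4, h5⟩ := hμ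
  have hv : v = ∑ k, μ k • (k : Vec m) :=
    sub_eq_zero.1 (norm_eq_zero.1 (le_antisymm h1 (norm_nonneg _)))
  intro z
  have key : ∀ k : S, μ k * inner ℝ (k : Vec m) (z - x) ≤ μ k * (f z - f x) := by
    intro k
    by_cases hk : k ∈ A
    · refine mul_le_mul_of_nonneg_left ?_ (h2 k)
      obtain ⟨a, ha, he⟩ := h.2 x
      have h6 := h5 k hk ⟨a, ha⟩
      rw [inner_sub_left] at h6
      rw [inner_sub_right]
      linarith [h.1 k k.2 z]
    · rw [h4 k hk]; simp
  have h7 := Finset.sum_le_sum fun k (_ : k ∈ Finset.univ) => key k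
  rw [← Finset.sum_mul, h3, one_mul] at h7
  rw [hv, sum_inner]
  simp only [inner_smul_left, conj_trivial]
  linarith

theorem IsMaxLinear.exists_multiplierSystem (h : IsMaxLinear S f) {x u v : Vec m}
    (hv : v ∈ subdiff f x) {t : ℝ} (ht : ‖u - v‖ ≤ t) :
    ∃ A μ, MultiplierSystem S A t x u μ := by
  classical
  have h1 := h.mem_convexHull hv
  rw [Finset.mem_convexHull'] at h1
  obtain ⟨ω, h2, h3, h4⟩ := h1
  rw [Finset.sum_filter, ← Finset.sum_coe_sort] at h3 h4
  refine ⟨Finset.univ.filter fun k : S => (inner ℝ (k : Vec m) x : ℝ) = f x,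
    fun k => if (inner ℝ (k : Vec m) x : ℝ) = f x then ω k else 0, ?_, fun k => ?_, h3,
    fun k hk => ?_, fun k hk j => ?_⟩
  · simp only [ite_smul, zero_smul]
    rwa [h4]
  · dsimp only
    split_ifs with hk
    · exact h2 k (by simp [hk])
    · exact le_rfl
  · simpa using fun hk' => absurd (by simpa using hk') hk
  · rw [inner_sub_left, (Finset.mem_filter.1 hk).2, sub_nonpos]
    exact h.1 j j.2 x

theorem isLinearSystem_multiplierSystem {E : Type*} [NormedAddCommGroup E] [NormedSpace ℝ E]
    (S : Finset (Vec m)) (A : Finset S) (xm vm : E →L[ℝ] Vec m) (mm : E →L[ℝ] (S → ℝ)) :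
    IsLinearSystem fun t e => MultiplierSystem S A t (xm e) (vm e) (mm e) := by
  let pr : S → E →L[ℝ] ℝ := fun k => (ContinuousLinearMap.proj k).comp mm
  have hpr : ∀ k e, pr k e = mm e k := fun _ _ => rfl
  refine IsLinearSystem.and ?_ (IsLinearSystem.and ?_ (IsLinearSystem.and ?_
    (IsLinearSystem.and ?_ ?_)))
  · simpa [hpr] using isLinearSystem_norm_le (vm - ∑ k, (pr k).smulRight (k : Vec m)) 0
  · exact IsLinearSystem.forall fun k => by
      simpa [hpr] using isLinearSystem_le (-pr k) 0 0 le_rfl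
  · simpa [hpr] using isLinearSystem_eq (∑ k, pr k) 1
  · exact IsLinearSystem.forall fun k => isLinearSystem_imp fun _ => isLinearSystem_eq (pr k) 0
  · exact IsLinearSystem.forall fun k => isLinearSystem_imp fun _ => IsLinearSystem.forall fun j => by
      simpa only [ContinuousLinearMap.comp_apply, innerSL_apply_apply, zero_mul, add_zero]
        using isLinearSystem_le ((innerSL ℝ ((j : Vec m) - k)).comp xm) 0 0 le_rfl

end MaxLinear

/-! ### The error bound for piecewise linear-quadratic objectives -/

section ErrorBound

variable {n p g : ℕ}

theorem Problem.exists_errorBound (P : Problem n p g) (hP : Function.Injective P.group) {r : ℝ}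
    (hr : 0 ≤ r) : ∃ κ : ℝ, 0 < κ ∧ ErrorBound P κ r := by
  obtain ⟨S, hS⟩ := exists_isMaxLinear_rankLoss n
  obtain ⟨T, hT⟩ := P.exists_isMaxLinear_reg hP
  let V := Point n p × (S → ℝ) × (T → ℝ)
  let Q : Finset S → Finset T → ℝ → V → Prop := fun A B t e =>
    ‖(P.y + e.1.2.1 - mulVecL P.X e.1.2.2)‖ ≤ t ∧ MultiplierSystem S A t e.1.2.1 e.1.1 e.2.1 ∧
      MultiplierSystem T B t e.1.2.2 (-mulVecL P.X.transpose e.1.1) e.2.2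
  have hlin : ∀ A B, IsLinearSystem (Q A B) := fun A B => by
    let w : V →L[ℝ] Vec n :=
      (ContinuousLinearMap.fst ℝ _ _).comp (ContinuousLinearMap.fst ℝ _ _)
    let s : V →L[ℝ] Vec n := (ContinuousLinearMap.fst ℝ _ _).comp
      ((ContinuousLinearMap.snd ℝ _ _).comp (ContinuousLinearMap.fst ℝ _ _))
    let β : V →L[ℝ] Vec p := (ContinuousLinearMap.snd ℝ _ _).comp
      ((ContinuousLinearMap.snd ℝ _ _).comp (ContinuousLinearMap.fst ℝ _ _))
    let μ : V →L[ℝ] (S → ℝ) :=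
      (ContinuousLinearMap.fst ℝ _ _).comp (ContinuousLinearMap.snd ℝ _ _)
    let ν : V →L[ℝ] (T → ℝ) :=
      (ContinuousLinearMap.snd ℝ _ _).comp (ContinuousLinearMap.snd ℝ _ _)
    refine IsLinearSystem.and ?_ (IsLinearSystem.and
      (isLinearSystem_multiplierSystem S A s w μ)
      (isLinearSystem_multiplierSystem T B β (-(mulVecL P.X.transpose).comp w) ν))
    have := isLinearSystem_norm_le (s - (mulVecL P.X).comp β) (-P.y)
    convert this using 5 with t e
    simp [s, β]
    abel
  choose κ hκ0 hκ using fun A B => (hlin A B).exists_bound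
  set K := ∑ A, ∑ B, κ A B with hK
  have hK0 : 0 ≤ K := Finset.sum_nonneg fun A _ => Finset.sum_nonneg fun B _ => hκ0 A B
  have hle : ∀ A B, κ A B ≤ K := fun A B =>
    (Finset.single_le_sum (f := fun B => κ A B) (fun B _ => hκ0 A B) (Finset.mem_univ B)).trans
      (Finset.single_le_sum (f := fun A => ∑ B, κ A B)
        (fun A _ => Finset.sum_nonneg fun B _ => hκ0 A B) (Finset.mem_univ A))
  have hwn : ∀ z : Point n p, ‖z.1‖ ≤ wnorm 1 z ∧ ‖z.2.1‖ ≤ wnorm 1 z ∧ ‖z.2.2‖ ≤ wnorm 1 z :=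
    fun z => ⟨Real.le_sqrt_of_sq_le (by nlinarith [sq_nonneg ‖z.2.1‖, sq_nonneg ‖z.2.2‖]),
      Real.le_sqrt_of_sq_le (by nlinarith [sq_nonneg ‖z.1‖, sq_nonneg ‖z.2.2‖]),
      Real.le_sqrt_of_sq_le (by nlinarith [sq_nonneg ‖z.1‖, sq_nonneg ‖z.2.1‖])⟩
  have hwn' : ∀ z : Point n p, wnorm 1 z ≤ 2 * ‖z‖ := fun z => by
    have h1 : ‖z.1‖ ≤ ‖z‖ := norm_fst_le z
    have h2 : ‖z.2.1‖ ≤ ‖z‖ := (norm_fst_le z.2).trans (norm_snd_le z)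
    have h3 : ‖z.2.2‖ ≤ ‖z‖ := (norm_snd_le z.2).trans (norm_snd_le z)
    refine Real.sqrt_le_iff.2 ⟨by positivity, ?_⟩
    have := pow_le_pow_left₀ (norm_nonneg _) h1 2
    have := pow_le_pow_left₀ (norm_nonneg _) h2 2
    have := pow_le_pow_left₀ (norm_nonneg _) h3 2
    nlinarith [sq_nonneg ‖z‖]
  have hlocal : ∀ z v : Point n p, v ∈ P.kktOp z → K * wnorm 1 v ≤ 1 →
      eucDist z P.kktSet ≤ 2 * (K * wnorm 1 v) := by
    intro z v hv hsmall
    obtain ⟨h1, h2, h3⟩ := P.mem_kktOp.1 hv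
    obtain ⟨b1, b2, b3⟩ := hwn v
    have ht := wnorm_nonneg 1 v
    obtain ⟨A, μ, hμ⟩ := hS.exists_multiplierSystem (u := z.1) h2 (t := wnorm 1 v)
      (by rwa [sub_add_cancel_right, norm_neg])
    obtain ⟨B, ν, hν⟩ := hT.exists_multiplierSystem (u := -mulVecL P.X.transpose z.1) h3
      (t := wnorm 1 v) (by rwa [neg_sub_left, sub_add_cancel, norm_neg])
    have hm := mul_le_mul_of_nonneg_right (hle A B) ht
    obtain ⟨y, ⟨hy1, hy2, hy3⟩, hxy⟩ := hκ A B (z, μ, ν) (wnorm 1 v) ht (hm.trans hsmall)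
      ⟨h1 ▸ b1, hμ, hν⟩
    have hmem : y.1 ∈ P.kktSet := Problem.mem_kktSet.2
      ⟨norm_eq_zero.1 (le_antisymm hy1 (norm_nonneg _)), hS.mem_subdiff_of_multiplierSystem hy2,
        hT.mem_subdiff_of_multiplierSystem hy3⟩
    refine (wdist_le_wnorm 1 z hmem).trans ((hwn' _).trans ?_)
    have h4 : ‖z - y.1‖ ≤ ‖((z, μ, ν) : V) - y‖ := norm_fst_le (((z, μ, ν) : V) - y)
    linarith
  refine ⟨2 * K + r * K + 1, by positivity, fun z hz => ?_⟩
  have hne : (P.kktOp z).Nonempty := by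
    obtain ⟨a, ha⟩ := hS.subdiff_nonempty z.2.1
    obtain ⟨b, hb⟩ := hT.subdiff_nonempty z.2.2
    exact ⟨(P.y + z.2.1 - mulVecL P.X z.2.2, a - z.1, b + mulVecL P.X.transpose z.1),
      P.mem_kktOp.2 ⟨rfl, by simpa using ha, by simpa using hb⟩⟩
  have hκpos : 0 < 2 * K + r * K + 1 := by positivity
  rw [← inv_mul_le_iff₀ hκpos]
  refine le_csInf (hne.image _) ?_
  rintro _ ⟨v, hv, rfl⟩
  rw [inv_mul_le_iff₀ hκpos]
  have h0 : wnorm 1 (0 - v) = wnorm 1 v := by simp [wnorm]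
  simp only [h0]
  have ht := wnorm_nonneg 1 v
  have hKt : 0 ≤ K * wnorm 1 v := by positivity
  rcases le_or_gt (K * wnorm 1 v) 1 with h | h
  · have := hlocal z v hv h
    nlinarith [mul_nonneg hr hKt]
  · nlinarith [mul_le_mul_of_nonneg_left h.le hr]

end ErrorBound

end RankRegression

end

theorem theorem2 {n p g : ℕ} (hn : 2 ≤ n) (P : RankRegression.Problem n p g)
    (τ : ℝ) (σ δ : ℕ → ℝ)
    (w s : ℕ → RankRegression.Vec n) (β : ℕ → RankRegression.Vec p)
    (hrun : RankRegression.IsPALM P τ σ δ w s β) :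
    -- global convergence of the primal and of the dual iterates
    (∃ (s' : RankRegression.Vec n) (β' : RankRegression.Vec p),
      Tendsto s atTop (𝓝 s') ∧ Tendsto β atTop (𝓝 β') ∧ P.IsPrimalOptimal s' β') ∧
    (∃ w' : RankRegression.Vec n, Tendsto w atTop (𝓝 w') ∧ P.IsDualOptimal w') ∧
    -- existence of the constants for a piecewise linear-quadratic objective
    (Function.Injective P.group →
      ∀ r : ℝ, ∑' k, δ k < r → ∃ κ : ℝ, 0 < κ ∧ RankRegression.ErrorBound P κ r) ∧
    -- the rate
    (∀ r κ : ℝ, ∑' k, δ k < r → 0 < κ → RankRegression.ErrorBound P κ r →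
      RankRegression.eucDist (w 0, s 0, β 0) P.kktSet ≤ r - ∑' k, δ k →
      (∀ k, RankRegression.wdist τ (w (k + 1), s (k + 1), β (k + 1)) P.kktSet ≤
        RankRegression.rate κ τ (σ k) (δ k) *
          RankRegression.wdist τ (w k, s k, β k) P.kktSet) ∧
      -- Q-linear convergence, with the limit of the factors
      (∀ σ' : ℝ, Tendsto σ atTop (𝓝 σ') →
        Tendsto (fun k => RankRegression.rate κ τ (σ k) (δ k)) atTop
          (𝓝 (κ * max 1 τ / Real.sqrt (σ' ^ 2 + κ ^ 2 * (max 1 τ) ^ 2))) ∧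
        κ * max 1 τ / Real.sqrt (σ' ^ 2 + κ ^ 2 * (max 1 τ) ^ 2) < 1) ∧
      (∃ ρ : ℝ, 0 ≤ ρ ∧ ρ < 1 ∧ ∀ᶠ k in atTop,
        RankRegression.wdist τ (w (k + 1), s (k + 1), β (k + 1)) P.kktSet ≤
          ρ * RankRegression.wdist τ (w k, s k, β k) P.kktSet) ∧
      -- asymptotic Q-superlinear convergence
      (Tendsto σ atTop atTop →
        Tendsto (fun k => RankRegression.rate κ τ (σ k) (δ k)) atTop (𝓝 0) ∧
        (fun k => RankRegression.wdist τ (w (k + 1), s (k + 1), β (k + 1)) P.kktSet)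
          =o[atTop] (fun k => RankRegression.wdist τ (w k, s k, β k) P.kktSet))) := by
  have hδ := hrun.delta_summable.tendsto_atTop_zero
  refine ⟨?_, ?_, fun hP r hr => ?_, fun r κ _ hκ hEB h0 => ?_⟩
  · obtain ⟨z, hz, -, hs, hβ⟩ := hrun.tendsto_kktSet
    exact ⟨z.2.1, z.2.2, hs, hβ, RankRegression.Problem.isPrimalOptimal_of_mem_kktSet hz⟩
  · obtain ⟨z, hz, hw, -, -⟩ := hrun.tendsto_kktSet
    exact ⟨z.1, hw, RankRegression.Problem.isDualOptimal_of_mem_kktSet hz⟩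
  · exact P.exists_errorBound hP ((tsum_nonneg fun k => (hrun.delta_pos k).le).trans hr.le)
  · have hle := hrun.wdist_le hκ hEB h0
    refine ⟨hle, fun σ' hσ' => ?_, hrun.exists_linear_rate hκ hle, fun hσ => ?_⟩
    · have hpos : 0 < σ' :=
        hrun.sigma_pos.trans_le (ge_of_tendsto hσ' (Eventually.of_forall hrun.sigma_le))
      refine ⟨RankRegression.tendsto_rate_of_tendsto hδ hpos hσ', ?_⟩
      rw [← mul_pow]
      exact RankRegression.div_sqrt_lt_one hpos
    · have hrate := RankRegression.tendsto_rate_zero (κ := κ) (τ := τ) hδ hσ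
      refine ⟨hrate, isLittleO_iff.2 fun c hc => ?_⟩
      filter_upwards [hrate.eventually (gt_mem_nhds hc)] with k hk
      rw [Real.norm_of_nonneg (RankRegression.wdist_nonneg _ _ _),
        Real.norm_of_nonneg (RankRegression.wdist_nonneg _ _ _)]
      exact (hle k).trans
        (mul_le_mul_of_nonneg_right hk.le (RankRegression.wdist_nonneg _ _ _))
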